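/- **Setting.** Consider the linear functional language with the following syntax. *Kinds and types.* A kind is a subset of $\{D,S,E\}$ (discardable, shareable, escapable); modes are $\mathsf r,\mathsf w,\mathsf u$ (read-only, writable, unboxed) with kinds $\{D,S\},\{E\},\{D,S,E\}$. Types are $$\tau ::= \alpha \mid \alpha! \mid () \mid t \mid T\,\overline\tau\,m \mid \tau\to\rho \mid \langle \overline{C\,\tau}\rangle \mid \{\overline{f :: \tau^?}\}\,m ,$$ where $t$ is U8, U16, U32, U64 or Bool (with $|t| = 2^8,2^{16},2^{32},2^{64},2$), a field type $\tau^?$ is $\tau$ or $\mathsf{taken}\ \tau$, the constructors of a variant are distinct and unordered, and the field names of a record are distinct. Literals are natural numbers ($\mathsf{False}=0$, $\mathsf{True}=1$, characters are their codes). In a kind context $\Delta=\overline{\alpha :\kappa}$, the judgement $\Delta\vdash\tau:\kappa$ holds for every $\kappa$ if $\tau$ is $()$, $t$ or a function type; for $\alpha:\kappa'\in\Delta$, $\alpha$ has the kinds $\kappa\subseteq\kappa'$ and $\alpha!$ the kinds $\kappa\subseteq\kappa'!$, where $\kappa'!=\kappa'$ if $\{D,S\}\subseteq\kappa'$ and $\{D,S\}$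 otherwise; variants, records and abstract types have kind $\kappa$ if all their alternatives, non-taken fields, or type arguments do and, for the latter two, $\kappa$ is included in the kind of the mode. The type $\tau!$ is $\tau$ with $\mathsf w$ replaced by $\mathsf r$ and $\alpha$ by $\alpha!$, except inside function types; substituting $\rho$ for $\alpha$ turns $\alpha!$ into $\rho!$. *Programs and typing.* Expressions are variables, $()$, literals, type applications $f[\overline\tau]$ of top-level functions, primitive operators, application, $\mathbf{let}$, $\mathbf{let!}\,(\overline y)\,x=e_1\,\mathbf{in}\,e_2$, $\mathbf{if}$, $\mathbf{cast}$, $\mathbf{promote}$, $\mathbf{case}\ e_1\ \mathbf{of}\ C\,x\to e_2\ \mathbf{else}\ y\to e_3$, $\mathbf{esac}$, $C\,e$, unboxed struct literals, $e.f$, $\mathbf{put}\,e_1.f:=e_2$ and $\mathbf{take}\,x\,\{f=y\}=e_1\,\mathbf{in}\,e_2$. A program assigns to each function name $f$ a closed signature $\forall\overline{\alpha::\kappa}.\,\tau\to\tau'$ and either a body $\lambda x.e$ (a defined function) or nothing (an abstract function). A typing context $\Gamma$ assigns types to distinct variables; $\Gamma\rightsquigarrow\Gamma'$ means that $\Gamma'$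 results from discarding assumptions of types of kind $\{D\}$, and $\Gamma\rightsquigarrow\Gamma_1,\Gamma_2$ that each assumption of $\Gamma$ goes to one of $\Gamma_1,\Gamma_2$, or to both if its type has kind $\{S\}$. In $\Delta;\Gamma\vdash e:\tau$, - a variable $x$ of type $\tau$ requires $\Gamma\rightsquigarrow x:\tau$, while $()$, literals $\ell:t$ (with $\ell<|t|$) and $f[\overline\rho]:(\tau\to\tau')[\overline{\rho/\alpha}]$ (with $\Delta\vdash\rho_i:\kappa_i$) require $\Gamma\rightsquigarrow\emptyset$; - subexpressions evaluated one after the other receive contexts into which $\Gamma$ is split (after a list of arguments, of an operator or a struct literal, the remainder must weaken to $\emptyset$), the two branches of an $\mathbf{if}$ or $\mathbf{case}$ share one context, and bound variables are new to the context they extend; - $\mathbf{case}$ removes the matched constructor from the type of $y$, $C\,e$ has the one-constructor type $\langle C\,\tau\rangle$, $\mathbf{esac}$ is its inverse, $\mathbf{promote}$ adds alternatives to a variant type, and $\mathbf{cast}$ goes from $t'$ to $t$ if $|t'|\le|t|$; - in $\mathbf{let!}$, the $y_i:\tau_i$ have the types $\tau_i!$ in $e_1$ and $\tau_i$ in $e_2$,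 and the type of $e_1$ has kind $\{E\}$; - $e.f$ needs a record of kind $\{S\}$ and a non-taken field $f$; $\mathbf{take}$ and $\mathbf{put}$ need a record of mode $\neq\mathsf r$; $\mathbf{take}$ needs a non-taken field $f::\rho$ and marks it as taken, or leaves the type of the record unchanged if $\rho$ has kind $\{S\}$; $\mathbf{put}$ needs a taken field and makes it non-taken, or a non-taken field $f::\rho$ where $\rho$ has kind $\{D\}$. *Semantics.* In the value semantics, $V\vdash e\Downarrow v$ is the usual call-by-value big-step evaluation; values are literals, $()$, functions $\lambda x.e$, abstract functions $f[\overline\tau]$, variant values, records, and abstract values $a_v$. In the update semantics, $U\vdash e\mid\mu\Downarrow u\mid\mu'$ threads a store $\mu$, a partial function from pointers to values; values may also be pointers $p$, and $\mathbf{take}$, $e.f$ and $\mathbf{put}$ on a pointer read, respectively overwrite, the record stored there. Abstract functions are interpreted by user-supplied functions: a function $[\![f]\!]_v$ from values to values, and a (possibly partial) function $[\![f]\!]_u$ from pairs $(u,\mu)$ to such pairs. The user also supplies a relation $a_u\mid\mu:a_v:T\,\overline\tau\,m\,[\mathbf{ro}:r\ \mathbf{rw}:w]$ between abstract values. *Correspondence.*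 $u\mid\mu:v:\tau\,[\mathbf{ro}:r\ \mathbf{rw}:w]$, for closed $\tau$, is the inductive relation that relates - literals $\ell<|t|$ at $t$, and $()$, to themselves, with $r=w=\emptyset$; - $\lambda x.e$ to itself at $\tau\to\rho$ if $x:\tau\vdash e:\rho$, and abstract $f[\overline\rho]$ to itself at the instance at $\overline\rho$ of its signature, if $\vdash\rho_i:\kappa_i$ for each $i$, with $r=w=\emptyset$; - variant values with the same constructor and corresponding arguments; - unboxed records, when the values of their non-taken fields correspond with sets $r_i,w_i$ such that $w_i\cap(r_j\cup w_j)=\emptyset$ for $i\ne j$, with $r=\bigcup r_i$, $w=\bigcup w_i$; and unboxed abstract values by the user-supplied relation; - a pointer $p$ at a type of mode $\mathsf w$ (resp. $\mathsf r$) to a record or abstract value if the content $\mu(p)$ corresponds to it in the same way with sets $r_0,w_0$, where for $\mathsf w$: $p\notin r_0\cup w_0$ and $r=r_0$, $w=\{p\}\cup w_0$; for $\mathsf r$: $w_0=\emptyset$, $r=\{p\}\cup r_0$, $w=\emptyset$. $U\mid\mu:V:\Gamma\,[\mathbf{ro}:r\ \mathbf{rw}:w]$ means that for each $x_i:\tau_i\in\Gamma$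 the values of $x_i$ in $U$ and $V$ correspond at $\tau_i$ with sets $r_i,w_i$ such that $w_j\cap(r_k\cup w_k)=\emptyset$ for $j\neq k$, $r=\bigcup r_i$ and $w=\bigcup w_i$. Finally, $w\mid\mu\ \mathbf{frame}\ w'\mid\mu'$ means that for all $p$: if $p\notin w\cup w'$ then $\mu(p)=\mu'(p)$; if $p\in w\setminus w'$ then $\mu'(p)=\bot$; if $p\in w'\setminus w$ then $\mu(p)=\bot$. *Standing assumptions.* 1. The program is well-typed: the body of each defined function $f::\forall\overline{\alpha::\kappa}.\,\tau\to\tau'$ satisfies $\overline{\alpha:\kappa};\,x:\tau\vdash e:\tau'$. 2. The user-supplied relation on abstract values respects the intended meaning of pointer sets, kinds and $!$: whenever $a_u\mid\mu:a_v:T\,\overline\tau\,m\,[\mathbf{ro}:r\ \mathbf{rw}:w]$, then $r\cap w=\emptyset$; $\mu$ is defined on $r\cup w$; the same holds for every $\mu'$ that agrees with $\mu$ on $r\cup w$; $a_u\mid\mu:a_v:(T\,\overline\tau\,m)!\,[\mathbf{ro}:r\cup w\ \mathbf{rw}:\emptyset]$; $w=\emptyset$ if $T\,\overline\tau\,m$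 has kind $\{D\}$ or $\{S\}$; and $r=\emptyset$ if it has kind $\{E\}$. 3. Abstract functions preserve correspondence: if $f::\forall\overline{\alpha::\kappa}.\,\tau\to\tau'$ is abstract, $\vdash\rho_i:\kappa_i$ for each $i$, $u\mid\mu:v:\tau[\overline{\rho/\alpha}]\,[\mathbf{ro}:r\ \mathbf{rw}:w]$, $[\![f]\!]_v(v)=v'$ and $[\![f]\!]_u(u,\mu)=(u',\mu')$, then there are $r'\subseteq r$ and $w'$ with $u'\mid\mu':v':\tau'[\overline{\rho/\alpha}]\,[\mathbf{ro}:r'\ \mathbf{rw}:w']$ and $w\mid\mu\ \mathbf{frame}\ w'\mid\mu'$. **Theorem 2 (Value $\Rightarrow$ Update refinement).** If $\varepsilon;\Gamma\vdash e:\tau$, and $U\mid\mu:V:\Gamma\,[\mathbf{ro}:r\ \mathbf{rw}:w]$, and $U\vdash e\mid\mu\Downarrow u\mid\mu'$, then there exist a value $v$ and pointer sets $r'\subseteq r$ and $w'$ such that $V\vdash e\Downarrow v$, and $u\mid\mu':v:\tau\,[\mathbf{ro}:r'\ \mathbf{rw}:w']$, and $w\mid\mu\ \mathbf{frame}\ w'\mid\mu'$.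 -/

import Mathlib

namespace Cogent

/-! ## Types and kinds -/

inductive PrimTy
  | u8 | u16 | u32 | u64 | bool
  deriving DecidableEq

/-- The bound `|t|`: the literals of primitive type `t` are the naturals below it.
Booleans are `False = 0`, `True = 1`; characters are their codes. -/
def PrimTy.bound : PrimTy → ℕ
  | .u8 => 2 ^ 8
  | .u16 => 2 ^ 16
  | .u32 => 2 ^ 32
  | .u64 => 2 ^ 64
  | .bool => 2

/-- Permissions: discardable, shareable, escapable. -/
inductive Perm
  | D | S | E
  deriving DecidableEq

abbrev Kind := Finset Perm

/-- Storage modes: read-only, writable, unboxed. -/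
inductive Mode
  | ro | wr | unboxed
  deriving DecidableEq

def Mode.kind : Mode → Kind
  | .ro => {.D, .S}
  | .wr => {.E}
  | .unboxed => {.D, .S, .E}

/-- Types over `n` type variables. An alternative of a variant is determined by its constructor and
the order of alternatives is irrelevant, so a variant is a finite map from constructors to types.
A record is a sequence of `k` fields with distinct names; `taken i` says that field `i` is taken. -/
inductive Ty (n : ℕ) : Type
  | var (i : Fin n)
  | bvar (i : Fin n)
  | unit
  | prim (t : PrimTy)
  | abs (T : String) (k : ℕ) (τs : Fin k → Ty n) (m : Mode)
  | fn (τ ρ : Ty n)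
  | variant (cs : Finset String) (τs : {c // c ∈ cs} → Ty n)
  | record (k : ℕ) (fs : Fin k ↪ String) (taken : Fin k → Bool) (τs : Fin k → Ty n) (m : Mode)

def Kind.bang (κ : Kind) : Kind :=
  if ({Perm.D, Perm.S} : Kind) ⊆ κ then κ else {Perm.D, Perm.S}

def Mode.bang : Mode → Mode
  | .ro => .ro
  | .wr => .ro
  | .unboxed => .unboxed

def Ty.bang {n : ℕ} : Ty n → Ty n
  | .var i => .bvar i
  | .bvar i => .bvar i
  | .unit => .unit
  | .prim t => .prim t
  | .abs T k τs m => .abs T k (fun i => (τs i).bang) m.bang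
  | .fn τ ρ => .fn τ ρ
  | .variant cs τs => .variant cs (fun c => (τs c).bang)
  | .record k fs tk τs m => .record k fs tk (fun i => (τs i).bang) m.bang

/-- Instantiation of type variables: `α` becomes `σ α` and `α!` becomes `(σ α)!`. -/
def Ty.subst {n m : ℕ} (σ : Fin n → Ty m) : Ty n → Ty m
  | .var i => σ i
  | .bvar i => (σ i).bang
  | .unit => .unit
  | .prim t => .prim t
  | .abs T k τs md => .abs T k (fun i => (τs i).subst σ) md
  | .fn τ ρ => .fn (τ.subst σ) (ρ.subst σ)
  | .variant cs τs => .variant cs (fun c => (τs c).subst σ)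
  | .record k fs tk τs md => .record k fs tk (fun i => (τs i).subst σ) md

/-- The kinding judgement `Δ ⊢ τ :κ κ`. -/
inductive Kinding {n : ℕ} (Δ : Fin n → Kind) : Ty n → Kind → Prop
  | unit (κ : Kind) : Kinding Δ .unit κ
  | prim (t : PrimTy) (κ : Kind) : Kinding Δ (.prim t) κ
  | fn (τ ρ : Ty n) (κ : Kind) : Kinding Δ (.fn τ ρ) κ
  | var (i : Fin n) (κ : Kind) : κ ⊆ Δ i → Kinding Δ (.var i) κ
  | bvar (i : Fin n) (κ : Kind) : κ ⊆ (Δ i).bang → Kinding Δ (.bvar i) κ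
  | variant (cs : Finset String) (τs : {c // c ∈ cs} → Ty n) (κ : Kind) :
      (∀ c, Kinding Δ (τs c) κ) → Kinding Δ (.variant cs τs) κ
  | abs (T : String) (k : ℕ) (τs : Fin k → Ty n) (m : Mode) (κ : Kind) :
      κ ⊆ m.kind → (∀ i, Kinding Δ (τs i) κ) → Kinding Δ (.abs T k τs m) κ
  | record (k : ℕ) (fs : Fin k ↪ String) (tk : Fin k → Bool) (τs : Fin k → Ty n) (m : Mode)
      (κ : Kind) :
      κ ⊆ m.kind → (∀ i, tk i = false → Kinding Δ (τs i) κ) → Kinding Δ (.record k fs tk τs m) κ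

/-! ## Expressions and programs -/

/-- The names of the top-level functions with their numbers of type parameters, and the primitive
operators: their argument types, result type, and meaning as an operation on literals. -/
structure Sig where
  Fn : Type
  arity : Fn → ℕ
  Op : Type
  opArity : Op → ℕ
  opArg : (o : Op) → Fin (opArity o) → PrimTy
  opRes : Op → PrimTy
  opSem : (o : Op) → ((i : Fin (opArity o)) → Fin (opArg o i).bound) → Fin (opRes o).bound

/-- Expressions over `n` type variables. -/
inductive Expr (S : Sig) (n : ℕ) : Type
  | var (x : String)
  | unit
  | tapp (f : S.Fn) (ρs : Fin (S.arity f) → Ty n)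
  | primop (o : S.Op) (es : Fin (S.opArity o) → Expr S n)
  | app (e₁ e₂ : Expr S n)
  /-- `let x = e₁ in e₂` -/
  | letE (x : String) (e₁ e₂ : Expr S n)
  /-- `let! (ys) x = e₁ in e₂` -/
  | letBang (ys : List String) (x : String) (e₁ e₂ : Expr S n)
  | ite (e₁ e₂ e₃ : Expr S n)
  | lit (l : ℕ)
  | cast (t : PrimTy) (e : Expr S n)
  | promote (cs : Finset String) (τs : {c // c ∈ cs} → Ty n) (e : Expr S n)
  /-- `case e₁ of C x → e₂ else y → e₃` -/
  | case (e₁ : Expr S n) (C : String) (x : String) (e₂ : Expr S n) (y : String) (e₃ : Expr S n)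
  | esac (e : Expr S n)
  | con (C : String) (e : Expr S n)
  | struct (k : ℕ) (fs : Fin k ↪ String) (es : Fin k → Expr S n)
  | member (e : Expr S n) (f : String)
  /-- `put e₁.f := e₂` -/
  | put (e₁ : Expr S n) (f : String) (e₂ : Expr S n)
  /-- `take x {f = y} = e₁ in e₂` -/
  | take (x f y : String) (e₁ e₂ : Expr S n)

def Expr.subst {S : Sig} {n m : ℕ} (σ : Fin n → Ty m) : Expr S n → Expr S m
  | .var x => .var x
  | .unit => .unit
  | .tapp f ρs => .tapp f (fun i => (ρs i).subst σ)
  | .primop o es => .primop o (fun i => (es i).subst σ)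
  | .app e₁ e₂ => .app (e₁.subst σ) (e₂.subst σ)
  | .letE x e₁ e₂ => .letE x (e₁.subst σ) (e₂.subst σ)
  | .letBang ys x e₁ e₂ => .letBang ys x (e₁.subst σ) (e₂.subst σ)
  | .ite e₁ e₂ e₃ => .ite (e₁.subst σ) (e₂.subst σ) (e₃.subst σ)
  | .lit l => .lit l
  | .cast t e => .cast t (e.subst σ)
  | .promote cs τs e => .promote cs (fun c => (τs c).subst σ) (e.subst σ)
  | .case e₁ C x e₂ y e₃ => .case (e₁.subst σ) C x (e₂.subst σ) y (e₃.subst σ)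
  | .esac e => .esac (e.subst σ)
  | .con C e => .con C (e.subst σ)
  | .struct k fs es => .struct k fs (fun i => (es i).subst σ)
  | .member e f => .member (e.subst σ) f
  | .put e₁ f e₂ => .put (e₁.subst σ) f (e₂.subst σ)
  | .take x f y e₁ e₂ => .take x f y (e₁.subst σ) (e₂.subst σ)

/-- A function signature `∀ (αᵢ :: κᵢ). arg → res`. -/
structure PolyTy (n : ℕ) where
  kinds : Fin n → Kind
  arg : Ty n
  res : Ty n

inductive FunDef (S : Sig) (n : ℕ)
  | fn (π : PolyTy n) (x : String) (e : Expr S n)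
  | absFn (π : PolyTy n)

def FunDef.sig {S : Sig} {n : ℕ} : FunDef S n → PolyTy n
  | .fn π _ _ => π
  | .absFn π => π

/-- The definition environment of a program. -/
abbrev Prog (S : Sig) := (f : S.Fn) → FunDef S (S.arity f)

/-! ## Typing -/

/-- Type contexts and evaluation environments assign at most one entry to a variable. -/
abbrev Assoc (α : Type*) := String → Option α

def Assoc.empty {α : Type*} : Assoc α := fun _ => none

def Assoc.bind {α : Type*} (Γ : Assoc α) (x : String) (a : α) : Assoc α :=
  Function.update Γ x (some a)

abbrev Ctx (n : ℕ) := Assoc (Ty n)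

/-- Weakening: `Γ'` is `Γ` without some assumptions of discardable type. -/
def Weaken {n : ℕ} (Δ : Fin n → Kind) (Γ Γ' : Ctx n) : Prop :=
  ∀ x, Γ' x = Γ x ∨ (Γ' x = none ∧ ∃ τ, Γ x = some τ ∧ Kinding Δ τ {Perm.D})

/-- Splitting `Γ` into `Γ₁` and `Γ₂`: each assumption goes to one side, or to both if its type is
shareable. -/
def Split {n : ℕ} (Δ : Fin n → Kind) (Γ Γ₁ Γ₂ : Ctx n) : Prop :=
  ∀ x, (Γ₁ x = Γ x ∧ Γ₂ x = none) ∨ (Γ₁ x = none ∧ Γ₂ x = Γ x) ∨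
    (Γ₁ x = Γ x ∧ Γ₂ x = Γ x ∧ ∃ τ, Γ x = some τ ∧ Kinding Δ τ {Perm.S})

/-- `Γ` is split successively into the contexts `Γ' 0, Γ' 1, …` for a sequence of expressions, the
remainder being discardable. -/
def SplitList {n k : ℕ} (Δ : Fin n → Kind) (Γ : Ctx n) (Γ' : Fin k → Ctx n) : Prop :=
  ∃ Γs : Fin (k + 1) → Ctx n, Γs 0 = Γ ∧
    (∀ i : Fin k, Split Δ (Γs i.castSucc) (Γ' i) (Γs i.succ)) ∧
    Weaken Δ (Γs (Fin.last k)) Assoc.empty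

/-- The typing judgement `Δ; Γ ⊢ e : τ`. A context written `x : τ, Γ` presupposes that `x` is not
in the domain of `Γ`. -/
inductive Typing {S : Sig} (P : Prog S) {n : ℕ} (Δ : Fin n → Kind) :
    Ctx n → Expr S n → Ty n → Prop
  | var (Γ : Ctx n) (x : String) (τ : Ty n) :
      Weaken Δ Γ (Assoc.empty.bind x τ) → Typing P Δ Γ (.var x) τ
  | unit (Γ : Ctx n) : Weaken Δ Γ Assoc.empty → Typing P Δ Γ .unit .unit
  | lit (Γ : Ctx n) (l : ℕ) (t : PrimTy) :
      Weaken Δ Γ Assoc.empty → l < t.bound → Typing P Δ Γ (.lit l) (.prim t)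
  | primop (Γ : Ctx n) (o : S.Op) (es : Fin (S.opArity o) → Expr S n)
      (Γ' : Fin (S.opArity o) → Ctx n) :
      SplitList Δ Γ Γ' → (∀ i, Typing P Δ (Γ' i) (es i) (.prim (S.opArg o i))) →
      Typing P Δ Γ (.primop o es) (.prim (S.opRes o))
  | cast (Γ : Ctx n) (e : Expr S n) (t' t : PrimTy) :
      Typing P Δ Γ e (.prim t') → t'.bound ≤ t.bound → Typing P Δ Γ (.cast t e) (.prim t)
  | app (Γ Γ₁ Γ₂ : Ctx n) (e₁ e₂ : Expr S n) (ρ τ : Ty n) :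
      Split Δ Γ Γ₁ Γ₂ → Typing P Δ Γ₁ e₁ (.fn ρ τ) → Typing P Δ Γ₂ e₂ ρ →
      Typing P Δ Γ (.app e₁ e₂) τ
  | tapp (Γ : Ctx n) (f : S.Fn) (ρs : Fin (S.arity f) → Ty n) :
      Weaken Δ Γ Assoc.empty → (∀ i, Kinding Δ (ρs i) ((P f).sig.kinds i)) →
      Typing P Δ Γ (.tapp f ρs) (.fn ((P f).sig.arg.subst ρs) ((P f).sig.res.subst ρs))
  | case (Γ Γ₁ Γ₂ : Ctx n) (e₁ : Expr S n) (A x : String) (e₂ : Expr S n) (y : String)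
      (e₃ : Expr S n) (cs : Finset String) (τs : {c // c ∈ cs} → Ty n) (hA : A ∈ cs) (τ : Ty n) :
      Split Δ Γ Γ₁ Γ₂ → Typing P Δ Γ₁ e₁ (.variant cs τs) →
      Γ₂ x = none → Typing P Δ (Γ₂.bind x (τs ⟨A, hA⟩)) e₂ τ →
      Γ₂ y = none →
      Typing P Δ (Γ₂.bind y (.variant (cs.erase A)
        (fun c => τs ⟨c.1, Finset.mem_of_mem_erase c.2⟩))) e₃ τ →
      Typing P Δ Γ (.case e₁ A x e₂ y e₃) τ
  | con (Γ : Ctx n) (C : String) (e : Expr S n) (τ : Ty n) :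
      Typing P Δ Γ e τ → Typing P Δ Γ (.con C e) (.variant {C} (fun _ => τ))
  | promote (Γ : Ctx n) (e : Expr S n) (bs : Finset String) (ρs : {c // c ∈ bs} → Ty n)
      (cs : Finset String) (τs : {c // c ∈ cs} → Ty n) (hsub : bs ⊆ cs) :
      Typing P Δ Γ e (.variant bs ρs) → (∀ c, τs ⟨c.1, hsub c.2⟩ = ρs c) →
      Typing P Δ Γ (.promote cs τs e) (.variant cs τs)
  | esac (Γ : Ctx n) (e : Expr S n) (C : String) (τ : Ty n) :
      Typing P Δ Γ e (.variant {C} (fun _ => τ)) → Typing P Δ Γ (.esac e) τ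
  | letE (Γ Γ₁ Γ₂ : Ctx n) (x : String) (e₁ e₂ : Expr S n) (ρ τ : Ty n) :
      Split Δ Γ Γ₁ Γ₂ → Typing P Δ Γ₁ e₁ ρ →
      Γ₂ x = none → Typing P Δ (Γ₂.bind x ρ) e₂ τ →
      Typing P Δ Γ (.letE x e₁ e₂) τ
  /- `Γ` consists of the assumptions on `ys`, banged for `e₁` and restored for `e₂`, and of a rest
  that is split into `Γ₁` and `Γ₂`. -/
  | letBang (Γ Γ₁ Γ₂ : Ctx n) (ys : List String) (x : String) (e₁ e₂ : Expr S n) (ρ τ : Ty n) :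
      (∀ y ∈ ys, Γ y ≠ none) →
      Split Δ (fun z => if z ∈ ys then none else Γ z) Γ₁ Γ₂ →
      Kinding Δ ρ {Perm.E} →
      Typing P Δ (fun z => if z ∈ ys then (Γ z).map Ty.bang else Γ₁ z) e₁ ρ →
      x ∉ ys → Γ₂ x = none →
      Typing P Δ (Assoc.bind (fun z => if z ∈ ys then Γ z else Γ₂ z) x ρ) e₂ τ →
      Typing P Δ Γ (.letBang ys x e₁ e₂) τ
  | ite (Γ Γ₁ Γ₂ : Ctx n) (e₁ e₂ e₃ : Expr S n) (τ : Ty n) :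
      Split Δ Γ Γ₁ Γ₂ → Typing P Δ Γ₁ e₁ (.prim .bool) →
      Typing P Δ Γ₂ e₂ τ → Typing P Δ Γ₂ e₃ τ →
      Typing P Δ Γ (.ite e₁ e₂ e₃) τ
  | take₁ (Γ Γ₁ Γ₂ : Ctx n) (x f y : String) (e₁ e₂ : Expr S n)
      (k : ℕ) (fs : Fin k ↪ String) (tk : Fin k → Bool) (τs : Fin k → Ty n) (m : Mode)
      (j : Fin k) (τ : Ty n) :
      Split Δ Γ Γ₁ Γ₂ → m ≠ .ro → fs j = f → tk j = false →
      Typing P Δ Γ₁ e₁ (.record k fs tk τs m) →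
      x ≠ y → Γ₂ x = none → Γ₂ y = none →
      Typing P Δ ((Γ₂.bind y (τs j)).bind x (.record k fs (Function.update tk j true) τs m)) e₂ τ →
      Typing P Δ Γ (.take x f y e₁ e₂) τ
  | take₂ (Γ Γ₁ Γ₂ : Ctx n) (x f y : String) (e₁ e₂ : Expr S n)
      (k : ℕ) (fs : Fin k ↪ String) (tk : Fin k → Bool) (τs : Fin k → Ty n) (m : Mode)
      (j : Fin k) (τ : Ty n) :
      Split Δ Γ Γ₁ Γ₂ → Kinding Δ (τs j) {Perm.S} → m ≠ .ro → fs j = f → tk j = false →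
      Typing P Δ Γ₁ e₁ (.record k fs tk τs m) →
      x ≠ y → Γ₂ x = none → Γ₂ y = none →
      Typing P Δ ((Γ₂.bind y (τs j)).bind x (.record k fs tk τs m)) e₂ τ →
      Typing P Δ Γ (.take x f y e₁ e₂) τ
  | put₁ (Γ Γ₁ Γ₂ : Ctx n) (e₁ : Expr S n) (f : String) (e₂ : Expr S n)
      (k : ℕ) (fs : Fin k ↪ String) (tk : Fin k → Bool) (τs : Fin k → Ty n) (m : Mode)
      (j : Fin k) :
      Split Δ Γ Γ₁ Γ₂ → m ≠ .ro → fs j = f → tk j = true →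
      Typing P Δ Γ₁ e₁ (.record k fs tk τs m) → Typing P Δ Γ₂ e₂ (τs j) →
      Typing P Δ Γ (.put e₁ f e₂) (.record k fs (Function.update tk j false) τs m)
  | put₂ (Γ Γ₁ Γ₂ : Ctx n) (e₁ : Expr S n) (f : String) (e₂ : Expr S n)
      (k : ℕ) (fs : Fin k ↪ String) (tk : Fin k → Bool) (τs : Fin k → Ty n) (m : Mode)
      (j : Fin k) :
      Split Δ Γ Γ₁ Γ₂ → m ≠ .ro → fs j = f → tk j = false →
      Typing P Δ Γ₁ e₁ (.record k fs tk τs m) →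
      Kinding Δ (τs j) {Perm.D} → Typing P Δ Γ₂ e₂ (τs j) →
      Typing P Δ Γ (.put e₁ f e₂) (.record k fs tk τs m)
  | member (Γ : Ctx n) (e : Expr S n) (f : String)
      (k : ℕ) (fs : Fin k ↪ String) (tk : Fin k → Bool) (τs : Fin k → Ty n) (m : Mode)
      (j : Fin k) :
      Kinding Δ (.record k fs tk τs m) {Perm.S} → fs j = f → tk j = false →
      Typing P Δ Γ e (.record k fs tk τs m) →
      Typing P Δ Γ (.member e f) (τs j)
  | struct (Γ : Ctx n) (k : ℕ) (fs : Fin k ↪ String) (es : Fin k → Expr S n)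
      (τs : Fin k → Ty n) (Γ' : Fin k → Ctx n) :
      SplitList Δ Γ Γ' → (∀ i, Typing P Δ (Γ' i) (es i) (τs i)) →
      Typing P Δ Γ (.struct k fs es) (.record k fs (fun _ => false) τs .unboxed)

/-- A program is well-typed if the body of every function has the type that its signature claims. -/
def Prog.WellTyped {S : Sig} (P : Prog S) : Prop :=
  ∀ (f : S.Fn) (π : PolyTy (S.arity f)) (x : String) (e : Expr S (S.arity f)),
    P f = .fn π x e → Typing P π.kinds (Assoc.empty.bind x π.arg) e π.res

/-- The empty kind context. -/
def noVars : Fin 0 → Kind := Fin.elim0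

/-! ## Values, stores, and the user-supplied parts -/

/-- Values of the value semantics; `AV` is the type of abstract values. -/
inductive Val (S : Sig) (AV : Type*)
  | lit (l : ℕ)
  | unit
  | fn (x : String) (e : Expr S 0)
  | afn (f : S.Fn) (ρs : Fin (S.arity f) → Ty 0)
  | con (C : String) (v : Val S AV)
  | record (k : ℕ) (fs : Fin k ↪ String) (vs : Fin k → Val S AV)
  | abs (a : AV)

/-- Values of the update semantics; `Ptr` is the type of pointers. -/
inductive UVal (S : Sig) (AU Ptr : Type*)
  | lit (l : ℕ)
  | unit
  | fn (x : String) (e : Expr S 0)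
  | afn (f : S.Fn) (ρs : Fin (S.arity f) → Ty 0)
  | con (C : String) (u : UVal S AU Ptr)
  | record (k : ℕ) (fs : Fin k ↪ String) (us : Fin k → UVal S AU Ptr)
  | abs (a : AU)
  | ptr (p : Ptr)

abbrev Store (S : Sig) (AU Ptr : Type*) := Ptr → Option (UVal S AU Ptr)

/-- What the user supplies: the meaning of the abstract functions in the two semantics, and the
correspondence between the abstract values of the two semantics, at an abstract type `T τs m` and
with the sets of read-only and of writable pointers that are accessible from the value. The meaning
of an abstract function in the update semantics may be undefined in some stores (an allocator has
no result in a full store). -/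
structure Foreign (S : Sig) (AV AU Ptr : Type*) where
  valSem : S.Fn → Val S AV → Val S AV
  updSem : S.Fn → UVal S AU Ptr × Store S AU Ptr → Option (UVal S AU Ptr × Store S AU Ptr)
  absRel : AU → Store S AU Ptr → AV → String → (k : ℕ) → (Fin k → Ty 0) → Mode →
    Set Ptr → Set Ptr → Prop

/-! ## Dynamic semantics -/

/-- Value semantics `V ⊢ e ⇓ v`. -/
inductive VEval {S : Sig} {AV AU Ptr : Type*} (P : Prog S) (F : Foreign S AV AU Ptr) :
    Assoc (Val S AV) → Expr S 0 → Val S AV → Prop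
  | var (V : Assoc (Val S AV)) (x v) : V x = some v → VEval P F V (.var x) v
  | unit (V : Assoc (Val S AV)) : VEval P F V .unit .unit
  | funC (V : Assoc (Val S AV)) (f : S.Fn) (ρs π x e) : P f = .fn π x e →
      VEval P F V (.tapp f ρs) (.fn x (e.subst ρs))
  | funA (V : Assoc (Val S AV)) (f : S.Fn) (ρs π) : P f = .absFn π →
      VEval P F V (.tapp f ρs) (.afn f ρs)
  | lit (V : Assoc (Val S AV)) (l) : VEval P F V (.lit l) (.lit l)
  | cast (V : Assoc (Val S AV)) (t e l) : VEval P F V e (.lit l) → VEval P F V (.cast t e) (.lit l)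
  | appC (V : Assoc (Val S AV)) (e₁ e₂ x e v' v) :
      VEval P F V e₁ (.fn x e) → VEval P F V e₂ v' → VEval P F (Assoc.empty.bind x v') e v →
      VEval P F V (.app e₁ e₂) v
  | appA (V : Assoc (Val S AV)) (e₁ e₂ f ρs v' v) :
      VEval P F V e₁ (.afn f ρs) → VEval P F V e₂ v' → F.valSem f v' = v →
      VEval P F V (.app e₁ e₂) v
  | primop (V : Assoc (Val S AV)) (o : S.Op) (es)
      (l : (i : Fin (S.opArity o)) → Fin (S.opArg o i).bound) :
      (∀ i, VEval P F V (es i) (.lit (l i))) →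
      VEval P F V (.primop o es) (.lit (S.opSem o l))
  | letE (V : Assoc (Val S AV)) (x e₁ e₂ v' v) :
      VEval P F V e₁ v' → VEval P F (V.bind x v') e₂ v → VEval P F V (.letE x e₁ e₂) v
  | letBang (V : Assoc (Val S AV)) (ys x e₁ e₂ v' v) :
      VEval P F V e₁ v' → VEval P F (V.bind x v') e₂ v → VEval P F V (.letBang ys x e₁ e₂) v
  | iteT (V : Assoc (Val S AV)) (e₁ e₂ e₃ v) :
      VEval P F V e₁ (.lit 1) → VEval P F V e₂ v → VEval P F V (.ite e₁ e₂ e₃) v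
  | iteF (V : Assoc (Val S AV)) (e₁ e₂ e₃ v) :
      VEval P F V e₁ (.lit 0) → VEval P F V e₃ v → VEval P F V (.ite e₁ e₂ e₃) v
  | con (V : Assoc (Val S AV)) (C e v) : VEval P F V e v → VEval P F V (.con C e) (.con C v)
  | promote (V : Assoc (Val S AV)) (cs τs e C v) :
      VEval P F V e (.con C v) → VEval P F V (.promote cs τs e) (.con C v)
  | case₁ (V : Assoc (Val S AV)) (e₁ C x e₂ y e₃ v' v) :
      VEval P F V e₁ (.con C v') → VEval P F (V.bind x v') e₂ v →
      VEval P F V (.case e₁ C x e₂ y e₃) v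
  | case₂ (V : Assoc (Val S AV)) (e₁ C x e₂ y e₃ B v' v) :
      VEval P F V e₁ (.con B v') → B ≠ C → VEval P F (V.bind y (.con B v')) e₃ v →
      VEval P F V (.case e₁ C x e₂ y e₃) v
  | esac (V : Assoc (Val S AV)) (e C v) : VEval P F V e (.con C v) → VEval P F V (.esac e) v
  | struct (V : Assoc (Val S AV)) (k fs es vs) : (∀ i, VEval P F V (es i) (vs i)) →
      VEval P F V (.struct k fs es) (.record k fs vs)
  | member (V : Assoc (Val S AV)) (e f k fs vs) (j : Fin k) :
      VEval P F V e (.record k fs vs) → fs j = f → VEval P F V (.member e f) (vs j)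
  | take (V : Assoc (Val S AV)) (x f y e₁ e₂ k fs vs) (j : Fin k) (v) :
      VEval P F V e₁ (.record k fs vs) → fs j = f →
      VEval P F ((V.bind y (vs j)).bind x (.record k fs vs)) e₂ v →
      VEval P F V (.take x f y e₁ e₂) v
  | put (V : Assoc (Val S AV)) (e₁ f e₂ k fs vs) (j : Fin k) (v') :
      VEval P F V e₁ (.record k fs vs) → fs j = f → VEval P F V e₂ v' →
      VEval P F V (.put e₁ f e₂) (.record k fs (Function.update vs j v'))

open Classical in
/-- Update semantics `U ⊢ e | μ ⇓ u | μ'`. The expressions of a sequence are evaluated from left to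
right, through the intermediate stores `μs 0, …, μs k`. -/
inductive UEval {S : Sig} {AV AU Ptr : Type*} (P : Prog S) (F : Foreign S AV AU Ptr) :
    Assoc (UVal S AU Ptr) → Expr S 0 → Store S AU Ptr → UVal S AU Ptr → Store S AU Ptr → Prop
  | var (U : Assoc (UVal S AU Ptr)) (x μ u) : U x = some u → UEval P F U (.var x) μ u μ
  | unit (U : Assoc (UVal S AU Ptr)) (μ) : UEval P F U .unit μ .unit μ
  | funC (U : Assoc (UVal S AU Ptr)) (f : S.Fn) (ρs π x e μ) : P f = .fn π x e →
      UEval P F U (.tapp f ρs) μ (.fn x (e.subst ρs)) μ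
  | funA (U : Assoc (UVal S AU Ptr)) (f : S.Fn) (ρs π μ) : P f = .absFn π →
      UEval P F U (.tapp f ρs) μ (.afn f ρs) μ
  | lit (U : Assoc (UVal S AU Ptr)) (l μ) : UEval P F U (.lit l) μ (.lit l) μ
  | cast (U : Assoc (UVal S AU Ptr)) (t e l μ μ') :
      UEval P F U e μ (.lit l) μ' → UEval P F U (.cast t e) μ (.lit l) μ'
  | appC (U : Assoc (UVal S AU Ptr)) (e₁ e₂ x e u' u μ μ₁ μ₂ μ₃) :
      UEval P F U e₁ μ (.fn x e) μ₁ → UEval P F U e₂ μ₁ u' μ₂ →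
      UEval P F (Assoc.empty.bind x u') e μ₂ u μ₃ → UEval P F U (.app e₁ e₂) μ u μ₃
  | appA (U : Assoc (UVal S AU Ptr)) (e₁ e₂ f ρs u' u μ μ₁ μ₂ μ₃) :
      UEval P F U e₁ μ (.afn f ρs) μ₁ → UEval P F U e₂ μ₁ u' μ₂ →
      F.updSem f (u', μ₂) = some (u, μ₃) → UEval P F U (.app e₁ e₂) μ u μ₃
  | primop (U : Assoc (UVal S AU Ptr)) (o : S.Op) (es)
      (l : (i : Fin (S.opArity o)) → Fin (S.opArg o i).bound)
      (μs : Fin (S.opArity o + 1) → Store S AU Ptr) (μ μ') :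
      μs 0 = μ → (∀ i, UEval P F U (es i) (μs i.castSucc) (.lit (l i)) (μs i.succ)) →
      μs (Fin.last _) = μ' →
      UEval P F U (.primop o es) μ (.lit (S.opSem o l)) μ'
  | letE (U : Assoc (UVal S AU Ptr)) (x e₁ e₂ u' u μ μ₁ μ₂) :
      UEval P F U e₁ μ u' μ₁ → UEval P F (U.bind x u') e₂ μ₁ u μ₂ →
      UEval P F U (.letE x e₁ e₂) μ u μ₂
  | letBang (U : Assoc (UVal S AU Ptr)) (ys x e₁ e₂ u' u μ μ₁ μ₂) :
      UEval P F U e₁ μ u' μ₁ → UEval P F (U.bind x u') e₂ μ₁ u μ₂ →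
      UEval P F U (.letBang ys x e₁ e₂) μ u μ₂
  | iteT (U : Assoc (UVal S AU Ptr)) (e₁ e₂ e₃ u μ μ₁ μ₂) :
      UEval P F U e₁ μ (.lit 1) μ₁ → UEval P F U e₂ μ₁ u μ₂ → UEval P F U (.ite e₁ e₂ e₃) μ u μ₂
  | iteF (U : Assoc (UVal S AU Ptr)) (e₁ e₂ e₃ u μ μ₁ μ₂) :
      UEval P F U e₁ μ (.lit 0) μ₁ → UEval P F U e₃ μ₁ u μ₂ → UEval P F U (.ite e₁ e₂ e₃) μ u μ₂
  | con (U : Assoc (UVal S AU Ptr)) (C e u μ μ') :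
      UEval P F U e μ u μ' → UEval P F U (.con C e) μ (.con C u) μ'
  | promote (U : Assoc (UVal S AU Ptr)) (cs τs e C u μ μ') :
      UEval P F U e μ (.con C u) μ' → UEval P F U (.promote cs τs e) μ (.con C u) μ'
  | case₁ (U : Assoc (UVal S AU Ptr)) (e₁ C x e₂ y e₃ u' u μ μ₁ μ₂) :
      UEval P F U e₁ μ (.con C u') μ₁ → UEval P F (U.bind x u') e₂ μ₁ u μ₂ →
      UEval P F U (.case e₁ C x e₂ y e₃) μ u μ₂
  | case₂ (U : Assoc (UVal S AU Ptr)) (e₁ C x e₂ y e₃ B u' u μ μ₁ μ₂) :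
      UEval P F U e₁ μ (.con B u') μ₁ → B ≠ C → UEval P F (U.bind y (.con B u')) e₃ μ₁ u μ₂ →
      UEval P F U (.case e₁ C x e₂ y e₃) μ u μ₂
  | esac (U : Assoc (UVal S AU Ptr)) (e C u μ μ') :
      UEval P F U e μ (.con C u) μ' → UEval P F U (.esac e) μ u μ'
  | struct (U : Assoc (UVal S AU Ptr)) (k fs es us) (μs : Fin (k + 1) → Store S AU Ptr) (μ μ') :
      μs 0 = μ → (∀ i, UEval P F U (es i) (μs i.castSucc) (us i) (μs i.succ)) →
      μs (Fin.last k) = μ' →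
      UEval P F U (.struct k fs es) μ (.record k fs us) μ'
  | member₁ (U : Assoc (UVal S AU Ptr)) (e f k fs us) (j : Fin k) (μ μ') :
      UEval P F U e μ (.record k fs us) μ' → fs j = f → UEval P F U (.member e f) μ (us j) μ'
  | member₂ (U : Assoc (UVal S AU Ptr)) (e f p k fs us) (j : Fin k) (μ μ') :
      UEval P F U e μ (.ptr p) μ' → μ' p = some (.record k fs us) → fs j = f →
      UEval P F U (.member e f) μ (us j) μ'
  | take₁ (U : Assoc (UVal S AU Ptr)) (x f y e₁ e₂ k fs us) (j : Fin k) (u μ μ₁ μ₂) :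
      UEval P F U e₁ μ (.record k fs us) μ₁ → fs j = f →
      UEval P F ((U.bind y (us j)).bind x (.record k fs us)) e₂ μ₁ u μ₂ →
      UEval P F U (.take x f y e₁ e₂) μ u μ₂
  | take₂ (U : Assoc (UVal S AU Ptr)) (x f y e₁ e₂ p k fs us) (j : Fin k) (u μ μ₁ μ₂) :
      UEval P F U e₁ μ (.ptr p) μ₁ → μ₁ p = some (.record k fs us) → fs j = f →
      UEval P F ((U.bind y (us j)).bind x (.ptr p)) e₂ μ₁ u μ₂ →
      UEval P F U (.take x f y e₁ e₂) μ u μ₂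
  | put₁ (U : Assoc (UVal S AU Ptr)) (e₁ f e₂ k fs us) (j : Fin k) (u' μ μ₁ μ₂) :
      UEval P F U e₁ μ (.record k fs us) μ₁ → fs j = f → UEval P F U e₂ μ₁ u' μ₂ →
      UEval P F U (.put e₁ f e₂) μ (.record k fs (Function.update us j u')) μ₂
  | put₂ (U : Assoc (UVal S AU Ptr)) (e₁ f e₂ p k fs us) (j : Fin k) (u' μ μ₁ μ₂) :
      UEval P F U e₁ μ (.ptr p) μ₁ → UEval P F U e₂ μ₁ u' μ₂ →
      μ₂ p = some (.record k fs us) → fs j = f →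
      UEval P F U (.put e₁ f e₂) μ (.ptr p)
        (Function.update μ₂ p (some (.record k fs (Function.update us j u'))))

/-! ## Correspondence -/

/-- The pointer sets of a sequence of components, of which only those with `tk i = false` count:
`r` and `w` are the unions of the components' sets, and no writable pointer of one component is
accessible from another one. -/
def Separated {k : ℕ} {Ptr : Type*} (tk : Fin k → Bool) (rs ws : Fin k → Set Ptr)
    (r w : Set Ptr) : Prop :=
  (∀ i j, i ≠ j → tk i = false → tk j = false → Disjoint (ws i) (rs j ∪ ws j)) ∧
    r = (⋃ i, ⋃ _ : tk i = false, rs i) ∧ w = (⋃ i, ⋃ _ : tk i = false, ws i)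

/-- The correspondence `u | μ : v : τ [ro: r, rw: w]`. -/
inductive Rel {S : Sig} {AV AU Ptr : Type*} (P : Prog S) (F : Foreign S AV AU Ptr)
    (μ : Store S AU Ptr) :
    UVal S AU Ptr → Val S AV → Ty 0 → Set Ptr → Set Ptr → Prop
  | lit (l : ℕ) (t : PrimTy) : l < t.bound → Rel P F μ (.lit l) (.lit l) (.prim t) ∅ ∅
  | unit : Rel P F μ .unit .unit .unit ∅ ∅
  | variant (C : String) (u v) (cs : Finset String) (τs : {c // c ∈ cs} → Ty 0) (hC : C ∈ cs)
      (r w : Set Ptr) :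
      Rel P F μ u v (τs ⟨C, hC⟩) r w → Rel P F μ (.con C u) (.con C v) (.variant cs τs) r w
  | funC (x : String) (e : Expr S 0) (τ ρ : Ty 0) :
      Typing P noVars (Assoc.empty.bind x τ) e ρ →
      Rel P F μ (.fn x e) (.fn x e) (.fn τ ρ) ∅ ∅
  | funA (f : S.Fn) (π : PolyTy (S.arity f)) (ρs : Fin (S.arity f) → Ty 0) :
      P f = .absFn π → (∀ i, Kinding noVars (ρs i) (π.kinds i)) →
      Rel P F μ (.afn f ρs) (.afn f ρs) (.fn (π.arg.subst ρs) (π.res.subst ρs)) ∅ ∅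
  | recU (k : ℕ) (fs : Fin k ↪ String) (us vs) (tk : Fin k → Bool) (τs : Fin k → Ty 0)
      (rs ws : Fin k → Set Ptr) (r w : Set Ptr) :
      (∀ i, tk i = false → Rel P F μ (us i) (vs i) (τs i) (rs i) (ws i)) →
      Separated tk rs ws r w →
      Rel P F μ (.record k fs us) (.record k fs vs) (.record k fs tk τs .unboxed) r w
  | recW (p : Ptr) (k : ℕ) (fs : Fin k ↪ String) (us vs) (tk : Fin k → Bool) (τs : Fin k → Ty 0)
      (rs ws : Fin k → Set Ptr) (r w : Set Ptr) :
      μ p = some (.record k fs us) →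
      (∀ i, tk i = false → Rel P F μ (us i) (vs i) (τs i) (rs i) (ws i)) →
      Separated tk rs ws r w → p ∉ r ∪ w →
      Rel P F μ (.ptr p) (.record k fs vs) (.record k fs tk τs .wr) r ({p} ∪ w)
  | recR (p : Ptr) (k : ℕ) (fs : Fin k ↪ String) (us vs) (tk : Fin k → Bool) (τs : Fin k → Ty 0)
      (rs ws : Fin k → Set Ptr) (r : Set Ptr) :
      μ p = some (.record k fs us) →
      (∀ i, tk i = false → Rel P F μ (us i) (vs i) (τs i) (rs i) (ws i)) →
      Separated tk rs ws r ∅ →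
      Rel P F μ (.ptr p) (.record k fs vs) (.record k fs tk τs .ro) ({p} ∪ r) ∅
  | absU (au : AU) (av : AV) (T : String) (k : ℕ) (τs : Fin k → Ty 0) (r w : Set Ptr) :
      F.absRel au μ av T k τs .unboxed r w →
      Rel P F μ (.abs au) (.abs av) (.abs T k τs .unboxed) r w
  | absW (p : Ptr) (au : AU) (av : AV) (T : String) (k : ℕ) (τs : Fin k → Ty 0) (r w : Set Ptr) :
      μ p = some (.abs au) → F.absRel au μ av T k τs .wr r w → p ∉ r ∪ w →
      Rel P F μ (.ptr p) (.abs av) (.abs T k τs .wr) r ({p} ∪ w)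
  | absR (p : Ptr) (au : AU) (av : AV) (T : String) (k : ℕ) (τs : Fin k → Ty 0) (r : Set Ptr) :
      μ p = some (.abs au) → F.absRel au μ av T k τs .ro r ∅ →
      Rel P F μ (.ptr p) (.abs av) (.abs T k τs .ro) ({p} ∪ r) ∅

/-- The correspondence `U | μ : V : Γ [ro: r, rw: w]` of environments. -/
def EnvRel {S : Sig} {AV AU Ptr : Type*} (P : Prog S) (F : Foreign S AV AU Ptr)
    (U : Assoc (UVal S AU Ptr)) (μ : Store S AU Ptr) (V : Assoc (Val S AV)) (Γ : Ctx 0)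
    (r w : Set Ptr) : Prop :=
  ∃ rs ws : String → Set Ptr,
    (∀ x τ, Γ x = some τ →
      ∃ u v, U x = some u ∧ V x = some v ∧ Rel P F μ u v τ (rs x) (ws x)) ∧
    (∀ x y, x ≠ y → Γ x ≠ none → Γ y ≠ none → Disjoint (ws x) (rs y ∪ ws y)) ∧
    r = (⋃ x, ⋃ _ : Γ x ≠ none, rs x) ∧ w = (⋃ x, ⋃ _ : Γ x ≠ none, ws x)

/-- The framing relation `wᵢ | μᵢ frame wₒ | μₒ`. -/
structure Frame {S : Sig} {AU Ptr : Type*} (wi : Set Ptr) (μi : Store S AU Ptr)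
    (wo : Set Ptr) (μo : Store S AU Ptr) : Prop where
  inertia : ∀ p, p ∉ wi ∪ wo → μi p = μo p
  leak_freedom : ∀ p, p ∈ wi → p ∉ wo → μo p = none
  fresh_alloc : ∀ p, p ∉ wi → p ∈ wo → μi p = none

/-! ## Obligations on the user-supplied parts -/

/-- The user-supplied correspondence of abstract values respects the meaning of modes, kinds and
pointer sets. -/
structure Foreign.AbsRelAdmissible {S : Sig} {AV AU Ptr : Type*} (F : Foreign S AV AU Ptr) :
    Prop where
  /-- writable pointers are not read-only -/
  noalias : ∀ au μ av T k τs m r w, F.absRel au μ av T k τs m r w → Disjoint r w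
  /-- accessible pointers are allocated -/
  valid : ∀ au μ av T k τs m r w, F.absRel au μ av T k τs m r w → ∀ p ∈ r ∪ w, μ p ≠ none
  /-- only the contents of the accessible pointers matter -/
  footprint : ∀ au μ μ' av T k τs m r w, F.absRel au μ av T k τs m r w →
    (∀ p ∈ r ∪ w, μ' p = μ p) → F.absRel au μ' av T k τs m r w
  /-- `!` turns writable pointers into read-only ones -/
  bang : ∀ au μ av T k τs m r w, F.absRel au μ av T k τs m r w →
    F.absRel au μ av T k (fun i => (τs i).bang) m.bang (r ∪ w) ∅
  /-- values of discardable type hold no writable pointer -/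
  discardable : ∀ au μ av T k τs m r w, F.absRel au μ av T k τs m r w →
    Kinding noVars (.abs T k τs m) {Perm.D} → w = ∅
  /-- values of shareable type hold no writable pointer -/
  shareable : ∀ au μ av T k τs m r w, F.absRel au μ av T k τs m r w →
    Kinding noVars (.abs T k τs m) {Perm.S} → w = ∅
  /-- values of escapable type hold no read-only pointer -/
  escapable : ∀ au μ av T k τs m r w, F.absRel au μ av T k τs m r w →
    Kinding noVars (.abs T k τs m) {Perm.E} → r = ∅

/-- The standing assumption on abstract functions: at every instantiation that respects the kinds
of the signature, the two user-supplied meanings preserve types and correspondence. -/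
def Foreign.FunsCorrespond {S : Sig} {AV AU Ptr : Type*} (P : Prog S)
    (F : Foreign S AV AU Ptr) : Prop :=
  ∀ (f : S.Fn) (π : PolyTy (S.arity f)) (ρs : Fin (S.arity f) → Ty 0),
    P f = .absFn π → (∀ i, Kinding noVars (ρs i) (π.kinds i)) →
    ∀ (u u' : UVal S AU Ptr) (v v' : Val S AV) (μ μ' : Store S AU Ptr) (r w : Set Ptr),
      Rel P F μ u v (π.arg.subst ρs) r w →
      F.valSem f v = v' → F.updSem f (u, μ) = some (u', μ') →
      ∃ r' ⊆ r, ∃ w', Rel P F μ' u' v' (π.res.subst ρs) r' w' ∧ Frame w μ w' μ'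

end Cogent

namespace Cogent

/-! ## Type substitution -/

/-! The argument is one of ownership. In a correspondence with sets `r` and `w` the value owns the
pointers of `w`, may read those of `r`, and depends on the store only through `r ∪ w`, where the
store is defined (`Rel.of_eqOn`, `Rel.valid`). An evaluation that owns `w₁` changes or frees only
pointers of `w₁` and allocates only unused ones. Hence whatever avoids `w₁` still corresponds
afterwards, and avoids the pointers owned by the result as well (`Rel.frame`, `Frame.disjoint`).
Successive evaluations therefore do not interfere, once the splitting of the context splits the
pointer sets accordingly (`EnvRel.split`). The condition `r' ⊆ r` keeps the read-only pointers of an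
earlier result away from what a later evaluation owns.

Kinds make the splitting possible. A value of kind `D` or `S` owns nothing
(`Rel.writable_eq_empty`), so discarding it leaks no memory and sharing it creates no alias of an
owned pointer. A value of kind `E` has no read-only pointers (`Rel.readonly_eq_empty`), so the
result of the first expression of a `let!` keeps no access to variables that become writable again.
Update in place agrees with the copying of the value semantics because the pointer of a writable
record is owned by it and accessible neither from its fields nor from any other value.

The induction runs over the derivation of the update semantics, not over typing: the body of a
called function is no subexpression of the call. Its typing is supplied by the correspondence of
function values, and for instances of polymorphic functions ultimately by `Typing.subst`.
Accordingly the inductive statement `Refines` quantifies over the context, the type, the value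
environment and the pointer sets, and each case inverts the typing derivation. -/

theorem Mode.bang_bang (m : Mode) : m.bang.bang = m.bang := by cases m <;> rfl

theorem Ty.bang_bang {n : ℕ} (τ : Ty n) : τ.bang.bang = τ.bang := by
  induction τ with
  | abs T k τs m ih => simp [Ty.bang, ih, Mode.bang_bang]
  | variant cs τs ih => simp [Ty.bang, ih]
  | record k fs tk τs m ih => simp [Ty.bang, ih, Mode.bang_bang]
  | _ => rfl

/-- On `α` both sides are `(σ α)!` by definition; on `α!` the claim is the idempotence of `!`.
Function types need no induction hypothesis, as `!` does not enter them. -/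
theorem Ty.subst_bang {n m : ℕ} (σ : Fin n → Ty m) (τ : Ty n) :
    τ.bang.subst σ = (τ.subst σ).bang := by
  induction τ with
  | bvar i => simp [Ty.bang, Ty.subst, Ty.bang_bang]
  | abs T k τs m ih => simp [Ty.bang, Ty.subst, ih]
  | variant cs τs ih => simp [Ty.bang, Ty.subst, ih]
  | record k fs tk τs m ih => simp [Ty.bang, Ty.subst, ih]
  | _ => rfl

theorem Ty.subst_subst {n m l : ℕ} (ρ : Fin n → Ty m) (σ : Fin m → Ty l) (τ : Ty n) :
    (τ.subst ρ).subst σ = τ.subst (fun i => (ρ i).subst σ) := by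
  induction τ with
  | bvar i => simp [Ty.subst, Ty.subst_bang]
  | abs T k τs m ih => simp [Ty.subst, ih]
  | fn τ ρ ih₁ ih₂ => simp [Ty.subst, ih₁, ih₂]
  | variant cs τs ih => simp [Ty.subst, ih]
  | record k fs tk τs m ih => simp [Ty.subst, ih]
  | _ => rfl

/-! ### Kinds under `!` and instantiation -/

theorem Kinding.mono {n : ℕ} {Δ : Fin n → Kind} {τ : Ty n} {κ κ' : Kind}
    (h : Kinding Δ τ κ) (hκ : κ' ⊆ κ) : Kinding Δ τ κ' := by
  induction h with
  | unit => exact .unit _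
  | prim => exact .prim _ _
  | fn => exact .fn _ _ _
  | var i κ h => exact .var _ _ (hκ.trans h)
  | bvar i κ h => exact .bvar _ _ (hκ.trans h)
  | variant cs τs κ _ ih => exact .variant _ _ _ fun c => ih c hκ
  | abs T k τs m κ h _ ih => exact .abs _ _ _ _ _ (hκ.trans h) fun c => ih c hκ
  | record k fs tk τs m κ h _ ih => exact .record _ _ _ _ _ _ (hκ.trans h) fun c hc => ih c hc hκ

theorem Kind.bang_mono {κ κ' : Kind} (h : κ ⊆ κ') : κ.bang ⊆ κ'.bang := by
  unfold Kind.bang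
  split_ifs with h₁ h₂ h₂
  · exact h
  · exact absurd (h₁.trans h) h₂
  · exact h₂
  · exact subset_rfl

theorem Kind.bang_bang (κ : Kind) : κ.bang.bang = κ.bang := by
  unfold Kind.bang; split_ifs <;> simp_all

theorem Mode.bang_kind (m : Mode) : m.kind.bang ⊆ m.bang.kind := by
  cases m <;> decide

/-- This serves the case `α!` of `Kinding.subst`: the kind `κ!` granted to `α!` has to hold for `ρ!`
whenever `ρ` has kind `κ`. Since every type has kind `∅`, it also shows that every `τ!` is
discardable and shareable. -/
theorem Kinding.bang {n : ℕ} {Δ : Fin n → Kind} {τ : Ty n} {κ : Kind}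
    (h : Kinding Δ τ κ) : Kinding Δ τ.bang κ.bang := by
  induction h with
  | unit => exact .unit _
  | prim => exact .prim _ _
  | fn => exact .fn _ _ _
  | var i κ h => exact .bvar _ _ (Kind.bang_mono h)
  | bvar i κ h => exact .bvar _ _ ((Kind.bang_mono h).trans (Kind.bang_bang _).subset)
  | variant cs τs κ _ ih => exact .variant _ _ _ ih
  | abs T k τs m κ h _ ih =>
    exact .abs _ _ _ _ _ ((Kind.bang_mono h).trans m.bang_kind) ih
  | record k fs tk τs m κ h _ ih =>
    exact .record _ _ _ _ _ _ ((Kind.bang_mono h).trans m.bang_kind) ih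

theorem Kinding.subst {n m : ℕ} {Δ : Fin n → Kind} {Δ' : Fin m → Kind} {σ : Fin n → Ty m}
    (hσ : ∀ i, Kinding Δ' (σ i) (Δ i)) {τ : Ty n} {κ : Kind} (h : Kinding Δ τ κ) :
    Kinding Δ' (τ.subst σ) κ := by
  induction h with
  | unit => exact .unit _
  | prim => exact .prim _ _
  | fn => exact .fn _ _ _
  | var i κ h => exact (hσ i).mono h
  | bvar i κ h => exact (hσ i).bang.mono h
  | variant cs τs κ _ ih => exact .variant _ _ _ ih
  | abs T k τs m κ h _ ih => exact .abs _ _ _ _ _ h ih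
  | record k fs tk τs m κ h _ ih => exact .record _ _ _ _ _ _ h ih

/-! ### Instantiation of contexts and typing derivations -/

def Ctx.subst {n m : ℕ} (σ : Fin n → Ty m) (Γ : Ctx n) : Ctx m := fun x => (Γ x).map (Ty.subst σ)

theorem Ctx.subst_bind {n m : ℕ} (σ : Fin n → Ty m) (Γ : Ctx n) (x : String) (τ : Ty n) :
    Ctx.subst σ (Γ.bind x τ) = Assoc.bind (Ctx.subst σ Γ) x (τ.subst σ) := by
  funext y
  by_cases h : y = x
  · subst h; simp [Ctx.subst, Assoc.bind]
  · simp [Ctx.subst, Assoc.bind, h]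

theorem Ctx.subst_empty {n m : ℕ} (σ : Fin n → Ty m) : Ctx.subst σ Assoc.empty = Assoc.empty :=
  rfl

theorem Ctx.subst_eq_none {n m : ℕ} (σ : Fin n → Ty m) {Γ : Ctx n} {x : String} (h : Γ x = none) :
    Ctx.subst σ Γ x = none := by
  simp [Ctx.subst, h]

section Subst
variable {n m : ℕ} {Δ : Fin n → Kind} {Δ' : Fin m → Kind} {σ : Fin n → Ty m}

theorem Weaken.subst (hσ : ∀ i, Kinding Δ' (σ i) (Δ i)) {Γ Γ' : Ctx n} (h : Weaken Δ Γ Γ') :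
    Weaken Δ' (Ctx.subst σ Γ) (Ctx.subst σ Γ') := by
  intro x
  rcases h x with h | ⟨h, τ, hτ, hk⟩
  · exact .inl (by simp [Ctx.subst, h])
  · exact .inr ⟨by simp [Ctx.subst, h], _, by simp [Ctx.subst, hτ], hk.subst hσ⟩

theorem Split.subst (hσ : ∀ i, Kinding Δ' (σ i) (Δ i)) {Γ Γ₁ Γ₂ : Ctx n} (h : Split Δ Γ Γ₁ Γ₂) :
    Split Δ' (Ctx.subst σ Γ) (Ctx.subst σ Γ₁) (Ctx.subst σ Γ₂) := by
  intro x
  rcases h x with ⟨h₁, h₂⟩ | ⟨h₁, h₂⟩ | ⟨h₁, h₂, τ, hτ, hk⟩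
  · exact .inl (by simp [Ctx.subst, h₁, h₂])
  · exact .inr (.inl (by simp [Ctx.subst, h₁, h₂]))
  · exact .inr (.inr ⟨by simp [Ctx.subst, h₁], by simp [Ctx.subst, h₂], _,
      by simp [Ctx.subst, hτ], hk.subst hσ⟩)

theorem SplitList.subst (hσ : ∀ i, Kinding Δ' (σ i) (Δ i)) {k : ℕ} {Γ : Ctx n}
    {Γ' : Fin k → Ctx n} (h : SplitList Δ Γ Γ') :
    SplitList Δ' (Ctx.subst σ Γ) (fun i => Ctx.subst σ (Γ' i)) := by
  obtain ⟨Γs, h₀, hs, hl⟩ := h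
  exact ⟨fun i => Ctx.subst σ (Γs i), by simp [h₀], fun i => (hs i).subst hσ, hl.subst hσ⟩

/-- Typing is preserved by instantiation of the type variables. -/
theorem Typing.subst {S : Sig} {P : Prog S} (hσ : ∀ i, Kinding Δ' (σ i) (Δ i)) {Γ : Ctx n}
    {e : Expr S n} {τ : Ty n} (h : Typing P Δ Γ e τ) :
    Typing P Δ' (Ctx.subst σ Γ) (e.subst σ) (τ.subst σ) := by
  induction h with
  | var Γ x τ h =>
    refine .var _ _ _ ?_
    have := h.subst hσ
    rwa [Ctx.subst_bind] at this
  | unit Γ h => exact .unit _ (h.subst hσ)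
  | lit Γ l t h hl => exact .lit _ _ _ (h.subst hσ) hl
  | primop Γ o es Γ' h _ ih => exact .primop _ _ _ _ (h.subst hσ) ih
  | cast Γ e t' t _ hb ih => exact .cast _ _ t' _ ih hb
  | app Γ Γ₁ Γ₂ e₁ e₂ ρ τ h _ _ ih₁ ih₂ => exact .app _ _ _ _ _ _ _ (h.subst hσ) ih₁ ih₂
  | tapp Γ f ρs h hk =>
    have := Typing.tapp (P := P) (Δ := Δ') _ f (fun i => (ρs i).subst σ) (h.subst hσ)
      (fun i => (hk i).subst hσ)
    -- Instantiating the signature by `ρs` and then by `σ` is a single instantiation by the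
    -- composite.
    simpa only [Ty.subst, Expr.subst, Ty.subst_subst] using this
  | case Γ Γ₁ Γ₂ e₁ A x e₂ y e₃ cs τs hA τ h _ hx _ hy _ ih₁ ih₂ ih₃ =>
    rw [Ctx.subst_bind] at ih₂ ih₃
    exact .case _ _ _ _ _ _ _ _ _ cs _ hA _ (h.subst hσ) ih₁ (Ctx.subst_eq_none σ hx) ih₂
      (Ctx.subst_eq_none σ hy) ih₃
  | con Γ C e τ _ ih => exact .con _ _ _ _ ih
  | promote Γ e bs ρs cs τs hsub _ heq ih =>
    exact .promote _ _ bs _ _ _ hsub ih fun c => by simp [heq]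
  | esac Γ e C τ _ ih => exact .esac _ _ C _ ih
  | letE Γ Γ₁ Γ₂ x e₁ e₂ ρ τ h _ hx _ ih₁ ih₂ =>
    rw [Ctx.subst_bind] at ih₂
    exact .letE _ _ _ _ _ _ _ _ (h.subst hσ) ih₁ (Ctx.subst_eq_none σ hx) ih₂
  | letBang Γ Γ₁ Γ₂ ys x e₁ e₂ ρ τ hys h hk _ hx hx' _ ih₁ ih₂ =>
    rw [Ctx.subst_bind] at ih₂
    refine .letBang _ (Ctx.subst σ Γ₁) (Ctx.subst σ Γ₂) _ _ _ _ (ρ.subst σ) _ ?_ ?_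
      (hk.subst hσ) ?_ hx (Ctx.subst_eq_none σ hx') ?_
    · intro y hy
      simpa [Ctx.subst] using hys y hy
    · convert h.subst hσ using 1
      funext z
      by_cases hz : z ∈ ys <;> simp [Ctx.subst, hz]
    · convert ih₁ using 1
      funext z
      by_cases hz : z ∈ ys
      -- On the banged variables, `!` has to commute with instantiation.
      · cases hΓ : Γ z <;> simp [Ctx.subst, hz, hΓ, Ty.subst_bang]
      · simp [Ctx.subst, hz]
    · convert ih₂ using 2
      funext z
      by_cases hz : z ∈ ys <;> simp [Ctx.subst, hz]
  | ite Γ Γ₁ Γ₂ e₁ e₂ e₃ τ h _ _ _ ih₁ ih₂ ih₃ =>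
    exact .ite _ _ _ _ _ _ _ (h.subst hσ) ih₁ ih₂ ih₃
  | take₁ Γ Γ₁ Γ₂ x f y e₁ e₂ k fs tk τs m j τ h hm hf ht _ hxy hx hy _ ih₁ ih₂ =>
    rw [Ctx.subst_bind, Ctx.subst_bind] at ih₂
    exact .take₁ _ _ _ _ _ _ _ _ k fs tk _ m j _ (h.subst hσ) hm hf ht ih₁ hxy
      (Ctx.subst_eq_none σ hx) (Ctx.subst_eq_none σ hy) ih₂
  | take₂ Γ Γ₁ Γ₂ x f y e₁ e₂ k fs tk τs m j τ h hk hm hf ht _ hxy hx hy _ ih₁ ih₂ =>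
    rw [Ctx.subst_bind, Ctx.subst_bind] at ih₂
    exact .take₂ _ _ _ _ _ _ _ _ k fs tk _ m j _ (h.subst hσ) (hk.subst hσ) hm hf ht ih₁ hxy
      (Ctx.subst_eq_none σ hx) (Ctx.subst_eq_none σ hy) ih₂
  | put₁ Γ Γ₁ Γ₂ e₁ f e₂ k fs tk τs m j h hm hf ht _ _ ih₁ ih₂ =>
    exact .put₁ _ _ _ _ _ _ k fs tk _ m j (h.subst hσ) hm hf ht ih₁ ih₂
  | put₂ Γ Γ₁ Γ₂ e₁ f e₂ k fs tk τs m j h hm hf ht _ hk _ ih₁ ih₂ =>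
    exact .put₂ _ _ _ _ _ _ k fs tk _ m j (h.subst hσ) hm hf ht ih₁ (hk.subst hσ) ih₂
  | member Γ e f k fs tk τs m j hk hf ht _ ih =>
    exact .member _ _ _ k fs tk (fun i => (τs i).subst σ) m j (hk.subst hσ) hf ht ih
  | struct Γ k fs es τs Γ' h _ ih => exact .struct _ _ _ _ _ _ (h.subst hσ) ih

end Subst

/-! ## Families of pointer sets -/

/-- `Separated` for an arbitrary index type and an arbitrary set of components that count. -/
def SepOn {ι Ptr : Type*} (D : ι → Prop) (rs ws : ι → Set Ptr) (r w : Set Ptr) : Prop :=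
  (∀ i j, i ≠ j → D i → D j → Disjoint (ws i) (rs j ∪ ws j)) ∧
    r = (⋃ i, ⋃ _ : D i, rs i) ∧ w = (⋃ i, ⋃ _ : D i, ws i)

namespace SepOn
variable {ι Ptr : Type*} {D D' D₁ D₂ : ι → Prop} {rs ws : ι → Set Ptr} {r w : Set Ptr}

theorem mem_left (h : SepOn D rs ws r w) {p : Ptr} : p ∈ r ↔ ∃ i, D i ∧ p ∈ rs i := by
  simp [h.2.1]

theorem mem_right (h : SepOn D rs ws r w) {p : Ptr} : p ∈ w ↔ ∃ i, D i ∧ p ∈ ws i := by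
  simp [h.2.2]

theorem left_subset (h : SepOn D rs ws r w) {i : ι} (hi : D i) : rs i ⊆ r :=
  fun _ hp => h.mem_left.2 ⟨i, hi, hp⟩

theorem right_subset (h : SepOn D rs ws r w) {i : ι} (hi : D i) : ws i ⊆ w :=
  fun _ hp => h.mem_right.2 ⟨i, hi, hp⟩

theorem left_eq_empty (h : SepOn D rs ws r w) (hrs : ∀ i, D i → rs i = ∅) : r = ∅ :=
  Set.eq_empty_of_forall_notMem fun _ hp => by
    obtain ⟨i, hi, hpi⟩ := h.mem_left.1 hp
    simp [hrs i hi] at hpi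

theorem right_eq_empty (h : SepOn D rs ws r w) (hws : ∀ i, D i → ws i = ∅) : w = ∅ :=
  Set.eq_empty_of_forall_notMem fun _ hp => by
    obtain ⟨i, hi, hpi⟩ := h.mem_right.1 hp
    simp [hws i hi] at hpi

theorem mk_mem (hd : ∀ i j, i ≠ j → D i → D j → ∀ p ∈ ws i, p ∉ rs j ∧ p ∉ ws j)
    (hr : ∀ p, p ∈ r ↔ ∃ i, D i ∧ p ∈ rs i) (hw : ∀ p, p ∈ w ↔ ∃ i, D i ∧ p ∈ ws i) :
    SepOn D rs ws r w := by
  refine ⟨fun i j hij hi hj => Set.disjoint_left.2 fun p hp hp' => ?_, ?_, ?_⟩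
  · exact hp'.elim (hd i j hij hi hj p hp).1 (hd i j hij hi hj p hp).2
  · ext p; simp [hr]
  · ext p; simp [hw]

theorem notMem (h : SepOn D rs ws r w) {i j : ι} (hij : i ≠ j) (hi : D i) (hj : D j) {p : Ptr}
    (hp : p ∈ ws i) : p ∉ rs j ∧ p ∉ ws j := by
  have := Set.disjoint_left.1 (h.1 i j hij hi hj) hp
  simpa using this

/-- Separation compares different components only, so the diagonal has to come from `hd`. -/
theorem disjoint (h : SepOn D rs ws r w) (hd : ∀ i, D i → Disjoint (rs i) (ws i)) :
    Disjoint r w := by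
  rw [Set.disjoint_left]
  intro p hr hw
  obtain ⟨i, hi, hpi⟩ := h.mem_left.1 hr
  obtain ⟨j, hj, hpj⟩ := h.mem_right.1 hw
  by_cases hij : j = i
  · subst hij; exact Set.disjoint_left.1 (hd j hj) hpi hpj
  · exact (h.notMem hij hj hi hpj).1 hpi

theorem bang (h : SepOn D rs ws r w) : SepOn D (fun i => rs i ∪ ws i) (fun _ => ∅) (r ∪ w) ∅ :=
  mk_mem (by simp)
    (by intro p; simp only [Set.mem_union, h.mem_left, h.mem_right, ← exists_or]; grind) (by simp)

/-- The set-level form of context splitting. A component may go to both parts if it owns nothing;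
then it only contributes read-only pointers twice. -/
theorem split (h : SepOn D rs ws r w) (hD : ∀ i, D i ↔ D₁ i ∨ D₂ i)
    (hs : ∀ i, D₁ i → D₂ i → ws i = ∅) :
    ∃ r₁ w₁ r₂ w₂, SepOn D₁ rs ws r₁ w₁ ∧ SepOn D₂ rs ws r₂ w₂ ∧ r = r₁ ∪ r₂ ∧ w = w₁ ∪ w₂ ∧
      Disjoint w₁ (r₂ ∪ w₂) ∧ Disjoint w₂ (r₁ ∪ w₁) := by
  have key : ∀ i j, D₁ i ∧ D₂ j ∨ D₂ i ∧ D₁ j → ∀ p ∈ ws i, p ∉ rs j ∧ p ∉ ws j := by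
    intro i j hij p hp
    by_cases h' : i = j
    · subst h'; rcases hij with ⟨h₁, h₂⟩ | ⟨h₂, h₁⟩ <;> simp [hs i h₁ h₂] at hp
    · exact h.notMem h' ((hD i).2 (by tauto)) ((hD j).2 (by tauto)) hp
  refine ⟨_, _, _, _, ⟨fun i j hij hi hj => h.1 i j hij ((hD i).2 (.inl hi)) ((hD j).2 (.inl hj)),
    rfl, rfl⟩, ⟨fun i j hij hi hj => h.1 i j hij ((hD i).2 (.inr hi)) ((hD j).2 (.inr hj)),
    rfl, rfl⟩, ?_, ?_, ?_, ?_⟩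
  · ext p; simp only [h.mem_left, hD, Set.mem_union, Set.mem_iUnion, exists_prop]; grind
  · ext p; simp only [h.mem_right, hD, Set.mem_union, Set.mem_iUnion, exists_prop]; grind
  all_goals
    rw [Set.disjoint_left]
    simp only [Set.mem_union, Set.mem_iUnion, exists_prop]
    grind

/-- The dropped components own nothing, so `w` survives exactly and only `r` shrinks. That `w` is
preserved is what freedom from leaks requires. -/
theorem weaken (h : SepOn D rs ws r w) (hD : ∀ i, D' i → D i)
    (hs : ∀ i, D i → ¬ D' i → ws i = ∅) : ∃ r' ⊆ r, SepOn D' rs ws r' w := by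
  refine ⟨⋃ i, ⋃ _ : D' i, rs i, ?_, fun i j hij hi hj => h.1 i j hij (hD i hi) (hD j hj), rfl, ?_⟩
  · exact Set.iUnion₂_subset fun i hi => h.left_subset (hD i hi)
  · ext p
    simp only [h.mem_right, Set.mem_iUnion, exists_prop]
    constructor
    · rintro ⟨i, hi, hp⟩
      by_cases hi' : D' i
      · exact ⟨i, hi', hp⟩
      · simp [hs i hi hi'] at hp
    · rintro ⟨i, hi, hp⟩
      exact ⟨i, hD i hi, hp⟩

/-- The entries at `x` do not count beforehand, so overwriting them loses nothing. No relation
between `r'` and `w'` is needed, as they belong to the same component. -/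
theorem insert [DecidableEq ι] (h : SepOn D rs ws r w) {x : ι} {r' w' : Set Ptr} (hx : ¬ D x)
    (hD : ∀ i, D' i ↔ i = x ∨ D i) (h₁ : Disjoint w' (r ∪ w)) (h₂ : Disjoint w r') :
    SepOn D' (Function.update rs x r') (Function.update ws x w') (r' ∪ r) (w' ∪ w) := by
  have hne : ∀ i, D i → i ≠ x := by rintro i hi rfl; exact hx hi
  rw [Set.disjoint_left] at h₁ h₂
  refine mk_mem ?_ ?_ ?_
  · intro i j hij hi hj p hp
    rw [hD] at hi hj
    have hl := @h.mem_left
    have hr := @h.mem_right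
    have hn := @h.notMem
    simp only [Set.mem_union] at h₁
    rcases hi with rfl | hi <;> rcases hj with rfl | hj
    · exact absurd rfl hij
    · rw [Function.update_self] at hp
      rw [Function.update_of_ne (hne j hj), Function.update_of_ne (hne j hj)]
      grind
    · rw [Function.update_of_ne (hne i hi)] at hp
      rw [Function.update_self, Function.update_self]
      grind
    · rw [Function.update_of_ne (hne i hi)] at hp
      rw [Function.update_of_ne (hne j hj), Function.update_of_ne (hne j hj)]
      exact hn hij hi hj hp
  all_goals
    intro p
    simp only [Set.mem_union, h.mem_left, h.mem_right, hD]
    constructor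
    · rintro (hp | ⟨i, hi, hp⟩)
      · exact ⟨x, .inl rfl, by simpa using hp⟩
      · exact ⟨i, .inr hi, by simpa [Function.update_of_ne (hne i hi)] using hp⟩
    · rintro ⟨i, rfl | hi, hp⟩
      · exact .inl (by simpa using hp)
      · exact .inr ⟨i, hi, by simpa [Function.update_of_ne (hne i hi)] using hp⟩

theorem remove (h : SepOn D rs ws r w) {x : ι} (hx : D x) (hD : ∀ i, D' i ↔ i ≠ x ∧ D i) :
    ∃ r₀ w₀, SepOn D' rs ws r₀ w₀ ∧ r = rs x ∪ r₀ ∧ w = ws x ∪ w₀ ∧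
      Disjoint (ws x) (r₀ ∪ w₀) ∧ Disjoint w₀ (rs x ∪ ws x) := by
  obtain ⟨r₁, w₁, r₂, w₂, h₁, h₂, hr, hw, hd₁, hd₂⟩ :=
    h.split (D₁ := fun i => i = x) (D₂ := D') (by grind) (by grind)
  obtain rfl : r₁ = rs x := by ext p; simp [h₁.mem_left]
  obtain rfl : w₁ = ws x := by ext p; simp [h₁.mem_right]
  exact ⟨r₂, w₂, h₂, hr, hw, hd₁, hd₂⟩

theorem cons {k : ℕ} {rs ws : Fin k → Set Ptr} {r' w' : Set Ptr}
    (h : SepOn (fun _ => True) rs ws r w) (h₁ : Disjoint w' (r ∪ w)) (h₂ : Disjoint w r') :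
    SepOn (fun _ => True) (Fin.cons r' rs : Fin (k + 1) → Set Ptr) (Fin.cons w' ws)
      (r' ∪ r) (w' ∪ w) := by
  rw [Set.disjoint_left] at h₁ h₂
  have hl := @h.mem_left
  have hr := @h.mem_right
  have hn := @h.notMem
  simp only [Set.mem_union, true_and] at h₁ hl hr
  refine mk_mem ?_ ?_ ?_
  · intro i j hij _ _ p hp
    induction i using Fin.cases with
    | zero =>
      induction j using Fin.cases with
      | zero => exact absurd rfl hij
      | succ j => simp only [Fin.cons_zero, Fin.cons_succ] at *; grind
    | succ i =>
      induction j using Fin.cases with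
      | zero => simp only [Fin.cons_zero, Fin.cons_succ] at *; grind
      | succ j =>
        simp only [Fin.cons_succ] at *
        exact hn (fun h => hij (by rw [h])) trivial trivial hp
  all_goals
    intro p
    simp only [Set.mem_union, hl, hr, true_and, Fin.exists_fin_succ, Fin.cons_zero, Fin.cons_succ]

end SepOn

theorem separated_iff_sepOn {k : ℕ} {Ptr : Type*} {tk : Fin k → Bool} {rs ws : Fin k → Set Ptr}
    {r w : Set Ptr} : Separated tk rs ws r w ↔ SepOn (fun i => tk i = false) rs ws r w :=
  Iff.rfl

/-! ## Framing -/

namespace Frame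
variable {S : Sig} {AU Ptr : Type*} {w w' w'' s : Set Ptr} {μ μ' μ'' : Store S AU Ptr}

theorem refl (w : Set Ptr) (μ : Store S AU Ptr) : Frame w μ w μ :=
  ⟨fun _ _ => rfl, fun _ h h' => absurd h h', fun _ h h' => absurd h' h⟩

/-- The delicate pointers lie in `w'` but in neither `w` nor `w''`: they are allocated by the first
step and freed by the second, so the initial and the final store are both undefined there. -/
theorem trans (h₁ : Frame w μ w' μ') (h₂ : Frame w' μ' w'' μ'') : Frame w μ w'' μ'' := by
  obtain ⟨a₁, b₁, c₁⟩ := h₁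
  obtain ⟨a₂, b₂, c₂⟩ := h₂
  simp only [Set.mem_union, not_or] at a₁ a₂
  constructor
  · intro p hp
    simp only [Set.mem_union, not_or] at hp
    by_cases h : p ∈ w'
    · rw [c₁ p hp.1 h, b₂ p h hp.2]
    · rw [a₁ p ⟨hp.1, h⟩, a₂ p ⟨h, hp.2⟩]
  · intro p hp hp'
    by_cases h : p ∈ w'
    · exact b₂ p h hp'
    · rw [← a₂ p ⟨h, hp'⟩, b₁ p hp h]
  · intro p hp hp'
    by_cases h : p ∈ w'
    · exact c₁ p hp h
    · rw [a₁ p ⟨hp, h⟩, c₂ p h hp']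

/-- No disjointness is needed: a pointer of `s` lies in both sets, where the frame relation demands
nothing. -/
theorem union (h : Frame w μ w' μ') (s : Set Ptr) : Frame (w ∪ s) μ (w' ∪ s) μ' := by
  obtain ⟨a, b, c⟩ := h
  simp only [Set.mem_union, not_or] at a
  constructor <;> intro p <;> simp only [Set.mem_union, not_or]
  · exact fun hp => a p ⟨hp.1.1, hp.2.1⟩
  · rintro (hp | hp) ⟨h₁, h₂⟩
    · exact b p hp h₁
    · exact absurd hp h₂
  · rintro ⟨h₁, h₂⟩ (hp | hp)
    · exact c p h₁ hp
    · exact absurd hp h₂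

/-- A pointer of `w'` outside `w` was unallocated, whereas those of `s` were allocated. -/
theorem disjoint (h : Frame w μ w' μ') (hd : Disjoint w s) (hv : ∀ p ∈ s, μ p ≠ none) :
    Disjoint w' s :=
  Set.disjoint_left.2 fun p hp hs =>
    hv p hs (h.fresh_alloc p (fun hw => Set.disjoint_left.1 hd hw hs) hp)

theorem eq_of_disjoint (h : Frame w μ w' μ') (hd : Disjoint w s) (hv : ∀ p ∈ s, μ p ≠ none) :
    ∀ p ∈ s, μ' p = μ p := fun p hs =>
  (h.inertia p (by
    rintro (hp | hp)
    · exact Set.disjoint_left.1 hd hp hs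
    · exact Set.disjoint_left.1 (h.disjoint hd hv) hp hs)).symm

end Frame

/-! ## The correspondence of values -/

section Rel
variable {S : Sig} {AV AU Ptr : Type*} {P : Prog S} {F : Foreign S AV AU Ptr}
  {μ μ' : Store S AU Ptr} {u : UVal S AU Ptr} {v : Val S AV} {τ : Ty 0} {r w : Set Ptr}

theorem Rel.valid (hF : F.AbsRelAdmissible) (h : Rel P F μ u v τ r w) :
    ∀ p ∈ r ∪ w, μ p ≠ none := by
  have fields : ∀ {k : ℕ} {tk : Fin k → Bool} {rs ws : Fin k → Set Ptr} {r w : Set Ptr},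
      (∀ i, tk i = false → ∀ p ∈ rs i ∪ ws i, μ p ≠ none) → Separated tk rs ws r w →
      ∀ p ∈ r ∪ w, μ p ≠ none := by
    intro k tk rs ws r w ih hs p hp
    rw [separated_iff_sepOn] at hs
    rcases hp with hp | hp
    · obtain ⟨i, hi, hp⟩ := hs.mem_left.1 hp
      exact ih i hi p (.inl hp)
    · obtain ⟨i, hi, hp⟩ := hs.mem_right.1 hp
      exact ih i hi p (.inr hp)
  induction h with
  | lit => simp
  | unit => simp
  | variant C u v cs τs hC r w _ ih => exact ih
  | funC => simp
  | funA => simp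
  | recU k fs us vs tk τs rs ws r w _ hs ih => exact fields ih hs
  | recW p k fs us vs tk τs rs ws r w hp _ hs _ ih =>
    rintro q (hq | rfl | hq)
    · exact fields ih hs q (.inl hq)
    · simp [hp]
    · exact fields ih hs q (.inr hq)
  | recR p k fs us vs tk τs rs ws r hp _ hs ih =>
    rintro q ((rfl | hq) | hq)
    · simp [hp]
    · exact fields ih hs q (.inl hq)
    · exact absurd hq (Set.notMem_empty q)
  | absU au av T k τs r w h => exact hF.valid _ _ _ _ _ _ _ _ _ h
  | absW p au av T k τs r w hp h _ =>
    rintro q (hq | rfl | hq)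
    · exact hF.valid _ _ _ _ _ _ _ _ _ h q (.inl hq)
    · simp [hp]
    · exact hF.valid _ _ _ _ _ _ _ _ _ h q (.inr hq)
  | absR p au av T k τs r hp h =>
    rintro q ((rfl | hq) | hq)
    · simp [hp]
    · exact hF.valid _ _ _ _ _ _ _ _ _ h q (.inl hq)
    · exact absurd hq (Set.notMem_empty q)

theorem Rel.disjoint (hF : F.AbsRelAdmissible) (h : Rel P F μ u v τ r w) : Disjoint r w := by
  induction h with
  | lit => simp
  | unit => simp
  | variant C u v cs τs hC r w _ ih => exact ih
  | funC => simp
  | funA => simp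
  | recU k fs us vs tk τs rs ws r w _ hs ih => exact SepOn.disjoint hs ih
  | recW p k fs us vs tk τs rs ws r w hp _ hs hn ih =>
    have := SepOn.disjoint hs ih
    simp only [Set.mem_union, not_or] at hn
    simp [hn.1, this]
  | recR p k fs us vs tk τs rs ws r hp _ hs ih => simp
  | absU au av T k τs r w h => exact hF.noalias _ _ _ _ _ _ _ _ _ h
  | absW p au av T k τs r w hp h hn =>
    simp only [Set.mem_union, not_or] at hn
    simp [hn.1, hF.noalias _ _ _ _ _ _ _ _ _ h]
  | absR p au av T k τs r hp h => simp

/-- A box counts its own pointer among its pointer sets, so the agreement of the stores covers the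
contents that are read as well as everything accessible from them. -/
theorem Rel.of_eqOn (hF : F.AbsRelAdmissible) (h : Rel P F μ u v τ r w)
    (hμ : ∀ p ∈ r ∪ w, μ' p = μ p) : Rel P F μ' u v τ r w := by
  have fields : ∀ {k : ℕ} {tk : Fin k → Bool} {rs ws : Fin k → Set Ptr} {r w : Set Ptr},
      Separated tk rs ws r w → (∀ p ∈ r ∪ w, μ' p = μ p) →
      ∀ i, tk i = false → ∀ p ∈ rs i ∪ ws i, μ' p = μ p :=
    fun hs h i hi p hp =>
      h p (Set.union_subset_union (SepOn.left_subset hs hi) (SepOn.right_subset hs hi) hp)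
  induction h with
  | lit l t h => exact .lit _ _ h
  | unit => exact .unit
  | variant C u v cs τs hC r w _ ih => exact .variant _ _ _ _ _ hC _ _ (ih hμ)
  | funC x e τ ρ h => exact .funC _ _ _ _ h
  | funA f π ρs h h' => exact .funA _ _ _ h h'
  | recU k fs us vs tk τs rs ws r w _ hs ih =>
    exact .recU _ _ _ _ _ _ _ _ _ _ (fun i hi => ih i hi (fields hs hμ i hi)) hs
  | recW p k fs us vs tk τs rs ws r w hp _ hs hn ih =>
    refine .recW _ _ _ us _ _ _ rs ws _ _ ?_ (fun i hi => ih i hi (fields hs ?_ i hi)) hs hn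
    · rw [hμ p (by simp), hp]
    · exact fun q hq => hμ q (by simp only [Set.mem_union] at hq ⊢; tauto)
  | recR p k fs us vs tk τs rs ws r hp _ hs ih =>
    refine .recR _ _ _ us _ _ _ rs ws _ ?_ (fun i hi => ih i hi (fields hs ?_ i hi)) hs
    · rw [hμ p (by simp), hp]
    · exact fun q hq => hμ q (by simp only [Set.mem_union] at hq ⊢; tauto)
  | absU au av T k τs r w h => exact .absU _ _ _ _ _ _ _ (hF.footprint _ _ _ _ _ _ _ _ _ _ h hμ)
  | absW p au av T k τs r w hp h hn =>
    refine .absW _ au _ _ _ _ _ _ ?_ (hF.footprint _ _ _ _ _ _ _ _ _ _ h ?_) hn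
    · rw [hμ p (by simp), hp]
    · exact fun q hq => hμ q (by simp only [Set.mem_union] at hq ⊢; tauto)
  | absR p au av T k τs r hp h =>
    refine .absR _ au _ _ _ _ _ ?_ (hF.footprint _ _ _ _ _ _ _ _ _ _ h ?_)
    · rw [hμ p (by simp), hp]
    · exact fun q hq => hμ q (by simp only [Set.mem_union] at hq ⊢; tauto)

theorem Rel.frame (hF : F.AbsRelAdmissible) {w₀ w₀' : Set Ptr} (h : Rel P F μ u v τ r w)
    (hf : Frame w₀ μ w₀' μ') (hd : Disjoint w₀ (r ∪ w)) : Rel P F μ' u v τ r w :=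
  h.of_eqOn hF (hf.eq_of_disjoint hd (h.valid hF))

/-- The kind of a writable box is contained in `{E}`, a read-only box owns nothing by definition,
and unboxed aggregates inherit the claim from their components. Taken fields count neither for the
kind nor for the pointer sets. Leaving `κ` general settles `D` and `S` in one induction. -/
theorem Rel.writable_eq_empty (hF : F.AbsRelAdmissible) {κ : Kind} (h : Rel P F μ u v τ r w)
    (hk : Kinding noVars τ κ) (hκ : Perm.D ∈ κ ∨ Perm.S ∈ κ) : w = ∅ := by
  induction h with
  | variant C u v cs τs hC r w _ ih => cases hk with | variant _ _ _ hk => exact ih (hk _)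
  | recU k fs us vs tk τs rs ws r w _ hs ih =>
    cases hk with | record _ _ _ _ _ _ _ hk =>
    exact SepOn.right_eq_empty hs fun i hi => ih i hi (hk i hi)
  | recW =>
    cases hk with | record _ _ _ _ _ _ hm _ =>
    rcases hκ with hκ | hκ <;> simpa [Mode.kind] using hm hκ
  | absU au av T k τs r w h =>
    rcases hκ with hκ | hκ
    · exact hF.discardable _ _ _ _ _ _ _ _ _ h (hk.mono (by simpa using hκ))
    · exact hF.shareable _ _ _ _ _ _ _ _ _ h (hk.mono (by simpa using hκ))
  | absW =>
    cases hk with | abs _ _ _ _ _ hm _ =>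
    rcases hκ with hκ | hκ <;> simpa [Mode.kind] using hm hκ
  | _ => rfl

/-- A read-only box does not have kind `E`. The read-only pointers of a writable box are those of
its contents, to which the kind descends. -/
theorem Rel.readonly_eq_empty (hF : F.AbsRelAdmissible) (h : Rel P F μ u v τ r w)
    (hk : Kinding noVars τ {Perm.E}) : r = ∅ := by
  induction h with
  | variant C u v cs τs hC r w _ ih => cases hk with | variant _ _ _ hk => exact ih (hk _)
  | recU k fs us vs tk τs rs ws r w _ hs ih =>
    cases hk with | record _ _ _ _ _ _ _ hk =>
    exact SepOn.left_eq_empty hs fun i hi => ih i hi (hk i hi)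
  | recW p k fs us vs tk τs rs ws r w hp _ hs hn ih =>
    cases hk with | record _ _ _ _ _ _ _ hk =>
    exact SepOn.left_eq_empty hs fun i hi => ih i hi (hk i hi)
  | recR =>
    cases hk with | record _ _ _ _ _ _ hm _ =>
    simp [Mode.kind] at hm
  | absU au av T k τs r w h => exact hF.escapable _ _ _ _ _ _ _ _ _ h hk
  | absW p au av T k τs r w hp h hn =>
    cases hk with | abs _ _ _ _ _ hm hk =>
    exact hF.escapable _ _ _ _ _ _ _ _ _ h (.abs _ _ _ _ _ hm hk)
  | absR =>
    cases hk with | abs _ _ _ _ _ hm _ =>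
    simp [Mode.kind] at hm
  | _ => rfl

/-- A writable box becomes a read-only one: its own pointer and all that its contents own move to
the read-only side, where separation is vacuous. -/
theorem Rel.bang (hF : F.AbsRelAdmissible) (h : Rel P F μ u v τ r w) :
    Rel P F μ u v τ.bang (r ∪ w) ∅ := by
  induction h with
  | lit l t h => simpa [Ty.bang] using .lit _ _ h
  | unit => simpa [Ty.bang] using .unit
  | variant C u v cs τs hC r w _ ih => exact .variant _ _ _ _ _ hC _ _ ih
  | funC x e τ ρ h => simpa [Ty.bang] using .funC _ _ _ _ h
  | funA f π ρs h h' => simpa [Ty.bang] using .funA _ _ _ h h'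
  | recU k fs us vs tk τs rs ws r w _ hs ih =>
    exact .recU _ _ _ _ _ _ _ _ _ _ ih (SepOn.bang hs)
  | recW p k fs us vs tk τs rs ws r w hp _ hs hn ih =>
    rw [Set.union_left_comm]
    exact .recR _ _ _ us _ _ _ _ _ _ hp ih (SepOn.bang hs)
  | recR p k fs us vs tk τs rs ws r hp _ hs ih =>
    have := SepOn.bang hs
    rw [Set.union_empty] at this ⊢
    exact .recR _ _ _ us _ _ _ _ _ _ hp ih this
  | absU au av T k τs r w h => exact .absU _ _ _ _ _ _ _ (hF.bang _ _ _ _ _ _ _ _ _ h)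
  | absW p au av T k τs r w hp h hn =>
    rw [Set.union_left_comm]
    exact .absR _ _ _ _ _ _ _ hp (hF.bang _ _ _ _ _ _ _ _ _ h)
  | absR p au av T k τs r hp h =>
    have := hF.bang _ _ _ _ _ _ _ _ _ h
    rw [Set.union_empty] at this ⊢
    exact .absR _ _ _ _ _ _ _ hp this

end Rel

/-! ## The correspondence of environments -/

section EnvRel
variable {S : Sig} {AV AU Ptr : Type*} {P : Prog S} {F : Foreign S AV AU Ptr}
  {μ μ' : Store S AU Ptr} {U : Assoc (UVal S AU Ptr)} {V : Assoc (Val S AV)} {Γ Γ₁ Γ₂ : Ctx 0}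
  {r w : Set Ptr}

theorem EnvRel.valid (hF : F.AbsRelAdmissible) (h : EnvRel P F U μ V Γ r w) :
    ∀ p ∈ r ∪ w, μ p ≠ none := by
  obtain ⟨rs, ws, hv, hs⟩ := h
  have hs : SepOn (fun x => Γ x ≠ none) rs ws r w := hs
  have key : ∀ x, Γ x ≠ none → ∀ p ∈ rs x ∪ ws x, μ p ≠ none := by
    intro x hx
    obtain ⟨τ, hτ⟩ := Option.ne_none_iff_exists'.1 hx
    obtain ⟨u, v, -, -, h⟩ := hv x τ hτ
    exact h.valid hF
  rintro p (hp | hp)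
  · obtain ⟨x, hx, hp⟩ := hs.mem_left.1 hp
    exact key x hx p (.inl hp)
  · obtain ⟨x, hx, hp⟩ := hs.mem_right.1 hp
    exact key x hx p (.inr hp)

theorem EnvRel.frame (hF : F.AbsRelAdmissible) {w₀ w₀' : Set Ptr} (h : EnvRel P F U μ V Γ r w)
    (hf : Frame w₀ μ w₀' μ') (hd : Disjoint w₀ (r ∪ w)) : EnvRel P F U μ' V Γ r w := by
  obtain ⟨rs, ws, hv, hs⟩ := h
  refine ⟨rs, ws, fun x τ hx => ?_, hs⟩
  obtain ⟨u, v, hu, hv', h⟩ := hv x τ hx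
  have hs : SepOn (fun x => Γ x ≠ none) rs ws r w := hs
  refine ⟨u, v, hu, hv', h.frame hF hf (hd.mono_right ?_)⟩
  exact Set.union_subset_union (hs.left_subset (by simp [hx])) (hs.right_subset (by simp [hx]))

theorem EnvRel.weaken (hF : F.AbsRelAdmissible) (h : EnvRel P F U μ V Γ r w)
    (hw : Weaken noVars Γ Γ₁) : ∃ r₁ ⊆ r, EnvRel P F U μ V Γ₁ r₁ w := by
  obtain ⟨rs, ws, hv, hs⟩ := h
  have hs : SepOn (fun x => Γ x ≠ none) rs ws r w := hs
  obtain ⟨r₁, hr₁, hs₁⟩ := hs.weaken (D' := fun x => Γ₁ x ≠ none) (by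
      intro x hx
      rcases hw x with h | ⟨h, -⟩
      · rwa [← h]
      · exact absurd h hx) (by
      intro x hx hx'
      rcases hw x with h | ⟨h, τ, hτ, hk⟩
      · exact absurd (h ▸ hx) hx'
      · obtain ⟨u, v, -, -, h⟩ := hv x τ hτ
        exact h.writable_eq_empty hF hk (by simp))
  refine ⟨r₁, hr₁, rs, ws, fun x τ hx => hv x τ ?_, hs₁⟩
  rcases hw x with h | ⟨h, -⟩
  · rwa [← h]
  · simp [h] at hx

/-- Used wherever a context must weaken to the empty one: with nothing owned at the start, an
expression may return a value that owns nothing without leaking. -/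
theorem EnvRel.writable_eq_empty (hF : F.AbsRelAdmissible) (h : EnvRel P F U μ V Γ r w)
    (hw : Weaken noVars Γ Assoc.empty) : w = ∅ := by
  obtain ⟨_, -, _, _, -, h⟩ := h.weaken hF hw
  exact SepOn.right_eq_empty h (fun _ h => absurd rfl h)

theorem EnvRel.split (hF : F.AbsRelAdmissible) (h : EnvRel P F U μ V Γ r w)
    (hsp : Split noVars Γ Γ₁ Γ₂) :
    ∃ r₁ w₁ r₂ w₂, EnvRel P F U μ V Γ₁ r₁ w₁ ∧ EnvRel P F U μ V Γ₂ r₂ w₂ ∧ r = r₁ ∪ r₂ ∧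
      w = w₁ ∪ w₂ ∧ Disjoint w₁ (r₂ ∪ w₂) ∧ Disjoint w₂ (r₁ ∪ w₁) := by
  obtain ⟨rs, ws, hv, hs⟩ := h
  have hs : SepOn (fun x => Γ x ≠ none) rs ws r w := hs
  obtain ⟨r₁, w₁, r₂, w₂, h₁, h₂, h'⟩ := hs.split (D₁ := fun x => Γ₁ x ≠ none)
    (D₂ := fun x => Γ₂ x ≠ none) (by intro x; rcases hsp x with h | h | h <;> simp [h]) (by
      intro x hx₁ hx₂
      rcases hsp x with h | h | ⟨-, -, τ, hτ, hk⟩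
      · exact absurd h.2 hx₂
      · exact absurd h.1 hx₁
      · obtain ⟨u, v, -, -, h⟩ := hv x τ hτ
        exact h.writable_eq_empty hF hk (by simp))
  refine ⟨r₁, w₁, r₂, w₂, ⟨rs, ws, fun x τ hx => hv x τ ?_, h₁⟩,
    ⟨rs, ws, fun x τ hx => hv x τ ?_, h₂⟩, h'⟩
  all_goals rcases hsp x with h | h | h <;> simp_all

theorem EnvRel.empty (U : Assoc (UVal S AU Ptr)) (μ : Store S AU Ptr) (V : Assoc (Val S AV)) :
    EnvRel P F U μ V Assoc.empty ∅ ∅ :=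
  ⟨fun _ => ∅, fun _ => ∅, by simp [Assoc.empty], by simp, by simp, by simp⟩

/-- Only `Γ` has to be undefined at `x`. The environments may hold a stale value there, and
overwriting it is harmless because the correspondence looks at the domain of `Γ` only. -/
theorem EnvRel.bind {x : String} {u : UVal S AU Ptr} {v : Val S AV} {τ : Ty 0} {r' w' : Set Ptr}
    (h : EnvRel P F U μ V Γ r w) (hx : Γ x = none) (hu : Rel P F μ u v τ r' w')
    (h₁ : Disjoint w' (r ∪ w)) (h₂ : Disjoint w r') :
    EnvRel P F (U.bind x u) μ (V.bind x v) (Γ.bind x τ) (r' ∪ r) (w' ∪ w) := by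
  obtain ⟨rs, ws, hv, hs⟩ := h
  have hs : SepOn (fun x => Γ x ≠ none) rs ws r w := hs
  refine ⟨_, _, ?_, hs.insert (x := x) (by simp [hx]) ?_ h₁ h₂⟩
  · intro y σ hy
    by_cases hyx : y = x
    · subst hyx
      simp only [Assoc.bind, Function.update_self, Option.some.injEq] at hy ⊢
      subst hy
      exact ⟨_, _, rfl, rfl, hu⟩
    · simp only [Assoc.bind, Function.update_of_ne hyx] at hy ⊢
      exact hv y σ hy
  · intro y
    by_cases hyx : y = x
    · subst hyx; simp [Assoc.bind]
    · simp [Assoc.bind, hyx]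

/-- Unlike in `EnvRel.split`, `w₂` need not be disjoint from `r₁`: the pointers that `ys` own in the
second environment are read-only in the first. Nor is `r₁` bounded by `r`. Both are made good later
by the escapability of the result of the first expression. -/
theorem EnvRel.letBang (hF : F.AbsRelAdmissible) {ys : List String}
    (h : EnvRel P F U μ V Γ r w)
    (hsp : Split noVars (fun z => if z ∈ ys then none else Γ z) Γ₁ Γ₂) :
    ∃ r₁ w₁ r₂ w₂,
      EnvRel P F U μ V (fun z => if z ∈ ys then (Γ z).map Ty.bang else Γ₁ z) r₁ w₁ ∧
      EnvRel P F U μ V (fun z => if z ∈ ys then Γ z else Γ₂ z) r₂ w₂ ∧ r₂ ⊆ r ∧ w = w₁ ∪ w₂ ∧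
      Disjoint w₁ (r₂ ∪ w₂) := by
  obtain ⟨rs, ws, hv, hs⟩ := h
  have hs : SepOn (fun x => Γ x ≠ none) rs ws r w := hs
  -- All of `ys` goes to the second part, which retains ownership; the first part consists of the
  -- other variables only.
  obtain ⟨r₁, w₁, r₂, w₂, h₁, h₂, rfl, rfl, hd, -⟩ :=
    hs.split (D₁ := fun x => x ∉ ys ∧ Γ₁ x ≠ none)
    (D₂ := fun x => (if x ∈ ys then Γ x else Γ₂ x) ≠ none) (by
      intro x
      by_cases hx : x ∈ ys
      · simp [hx]
      · rcases hsp x with h | h | h <;> simp_all) (by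
      rintro x ⟨hx, hx₁⟩ hx₂
      rw [if_neg hx] at hx₂
      rcases hsp x with h | h | ⟨-, -, τ, hτ, hk⟩
      · exact absurd h.2 hx₂
      · exact absurd h.1 hx₁
      · simp only [hx, if_false] at hτ
        obtain ⟨u, v, -, -, h⟩ := hv x τ hτ
        exact h.writable_eq_empty hF hk (by simp))
  -- The first environment now receives read-only copies of `ys`. They contribute nothing writable,
  -- so its owned set remains `w₁`.
  refine ⟨⋃ x, ⋃ _ : (if x ∈ ys then (Γ x).map Ty.bang else Γ₁ x) ≠ none,
    if x ∈ ys then rs x ∪ ws x else rs x, w₁, r₂, w₂,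
    ⟨fun x => if x ∈ ys then rs x ∪ ws x else rs x,
    fun x => if x ∈ ys then ∅ else ws x, ?_, SepOn.mk_mem ?_ ?_ ?_⟩, ⟨rs, ws, ?_, h₂⟩,
    Set.subset_union_right, rfl, hd⟩
  · intro x τ hx
    by_cases hxy : x ∈ ys
    · simp only [hxy, if_true, Option.map_eq_some_iff] at hx ⊢
      obtain ⟨σ, hσ, rfl⟩ := hx
      obtain ⟨u, v, hu, hv', h⟩ := hv x σ hσ
      exact ⟨u, v, hu, hv', h.bang hF⟩
    · simp only [hxy, if_false] at hx ⊢
      refine hv x τ ?_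
      rcases hsp x with h | h | h <;> simp_all
  · have hD : ∀ x, (if x ∈ ys then (Γ x).map Ty.bang else Γ₁ x) ≠ none → Γ x ≠ none := by
      intro x hx
      by_cases hxy : x ∈ ys
      · simpa [hxy] using hx
      · rcases hsp x with h | h | h <;> simp_all
    intro x y hxy hx hy p hp
    by_cases hx' : x ∈ ys
    · simp [hx'] at hp
    · simp only [hx', if_false] at hp
      have := hs.notMem hxy (hD x hx) (hD y hy) hp
      by_cases hy' : y ∈ ys <;> simp [hy', this]
  · intro p; simp only [Set.mem_iUnion, exists_prop]
  · intro p
    rw [h₁.mem_right]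
    refine exists_congr fun x => ?_
    by_cases hx : x ∈ ys <;> simp [hx]
  · intro x τ hx
    refine hv x τ ?_
    by_cases hxy : x ∈ ys
    · simpa [hxy] using hx
    · rcases hsp x with h | h | h <;> simp_all

end EnvRel

/-! ## Records -/

section Records
variable {S : Sig} {AV AU Ptr : Type*} {P : Prog S} {F : Foreign S AV AU Ptr}
  {μ μ' : Store S AU Ptr} {k : ℕ} {us : Fin k → UVal S AU Ptr} {vs : Fin k → Val S AV}
  {tk : Fin k → Bool} {τs : Fin k → Ty 0} {r w r' w' : Set Ptr} {j : Fin k}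

/-- The non-taken fields of a record correspond, with disjoint pointer sets. -/
def FieldsRel (P : Prog S) (F : Foreign S AV AU Ptr) (μ : Store S AU Ptr)
    (us : Fin k → UVal S AU Ptr) (vs : Fin k → Val S AV) (tk : Fin k → Bool) (τs : Fin k → Ty 0)
    (r w : Set Ptr) : Prop :=
  ∃ rs ws : Fin k → Set Ptr, (∀ i, tk i = false → Rel P F μ (us i) (vs i) (τs i) (rs i) (ws i)) ∧
    Separated tk rs ws r w

/-- For reading a field while the record stays whole; `FieldsRel.take` instead separates the field
from the rest. -/
theorem FieldsRel.get (h : FieldsRel P F μ us vs tk τs r w) (hj : tk j = false) :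
    ∃ r' ⊆ r, ∃ w' ⊆ w, Rel P F μ (us j) (vs j) (τs j) r' w' := by
  obtain ⟨rs, ws, h, hs⟩ := h
  exact ⟨_, SepOn.left_subset hs hj, _, SepOn.right_subset hs hj, h j hj⟩

theorem FieldsRel.take (h : FieldsRel P F μ us vs tk τs r w) (hj : tk j = false) :
    ∃ r₁ w₁ r₀ w₀, Rel P F μ (us j) (vs j) (τs j) r₁ w₁ ∧
      FieldsRel P F μ us vs (Function.update tk j true) τs r₀ w₀ ∧ r = r₁ ∪ r₀ ∧ w = w₁ ∪ w₀ ∧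
      Disjoint w₁ (r₀ ∪ w₀) ∧ Disjoint w₀ (r₁ ∪ w₁) := by
  obtain ⟨rs, ws, h, hs⟩ := h
  have hD : ∀ i, Function.update tk j true i = false ↔ i ≠ j ∧ tk i = false := by
    intro i
    by_cases hij : i = j <;> simp [hij]
  obtain ⟨r₀, w₀, hs₀, h'⟩ := SepOn.remove hs hj hD
  exact ⟨_, _, r₀, w₀, h j hj, ⟨rs, ws, fun i hi => h i ((hD i).1 hi).2, hs₀⟩, h'⟩

theorem FieldsRel.put (h : FieldsRel P F μ us vs tk τs r w) (hj : tk j = true)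
    {u : UVal S AU Ptr} {v : Val S AV} (hu : Rel P F μ u v (τs j) r' w')
    (h₁ : Disjoint w' (r ∪ w)) (h₂ : Disjoint w r') :
    FieldsRel P F μ (Function.update us j u) (Function.update vs j v) (Function.update tk j false)
      τs (r' ∪ r) (w' ∪ w) := by
  obtain ⟨rs, ws, h, hs⟩ := h
  have hD : ∀ i, Function.update tk j false i = false ↔ i = j ∨ tk i = false := by
    intro i
    by_cases hij : i = j <;> simp [hij]
  refine ⟨_, _, fun i hi => ?_, SepOn.insert hs (by simp [hj]) hD h₁ h₂⟩
  by_cases hij : i = j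
  · subst hij; simpa using hu
  · simpa [hij] using h i (((hD i).1 hi).resolve_left hij)

theorem FieldsRel.of_eqOn (hF : F.AbsRelAdmissible) (h : FieldsRel P F μ us vs tk τs r w)
    (hμ : ∀ p ∈ r ∪ w, μ' p = μ p) : FieldsRel P F μ' us vs tk τs r w := by
  obtain ⟨rs, ws, h, hs⟩ := h
  exact ⟨rs, ws, fun i hi => (h i hi).of_eqOn hF fun p hp =>
    hμ p (Set.union_subset_union (SepOn.left_subset hs hi) (SepOn.right_subset hs hi) hp), hs⟩

/-- The value `u` is a record with the fields `us`, or points to one. -/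
def IsRecord (μ : Store S AU Ptr) (u : UVal S AU Ptr) (k : ℕ) (fs : Fin k ↪ String)
    (us : Fin k → UVal S AU Ptr) : Prop :=
  u = .record k fs us ∨ ∃ p, u = .ptr p ∧ μ p = some (.record k fs us)

/-- A record that is not read-only consists of its fields and of the pointer to it, if it is boxed;
its fields can be restricted or changed to other corresponding ones. -/
theorem Rel.record_inv {fs : Fin k ↪ String} {m : Mode} (hm : m ≠ .ro) {u : UVal S AU Ptr}
    {v : Val S AV} (h : Rel P F μ u v (.record k fs tk τs m) r w) {k' : ℕ} {fs' : Fin k' ↪ String}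
    {us' : Fin k' → UVal S AU Ptr} (hu : IsRecord μ u k' fs' us') :
    ∃ us vs s w₀, UVal.record (AU := AU) (Ptr := Ptr) k' fs' us' = .record k fs us ∧
      v = .record k fs vs ∧
      FieldsRel P F μ us vs tk τs r w₀ ∧ w = s ∪ w₀ ∧ Disjoint s (r ∪ w₀) ∧
      ∀ tk' r' w', FieldsRel P F μ us vs tk' τs r' w' → Disjoint s (r' ∪ w') →
        Rel P F μ u (.record k fs vs) (.record k fs tk' τs m) r' (s ∪ w') := by
  cases h with
  | recU _ _ us vs _ _ rs ws _ _ h hs =>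
    refine ⟨us, vs, ∅, w, ?_, rfl, ⟨rs, ws, h, hs⟩, by simp, by simp, ?_⟩
    · rcases hu with hu | ⟨p, hu, -⟩
      · exact hu.symm
      · cases hu
    · rintro tk' r' w' ⟨rs, ws, h, hs⟩ -
      rw [Set.empty_union]
      exact .recU _ _ _ _ _ _ _ _ _ _ h hs
  | recW p _ _ us vs _ _ rs ws _ w₀ hp h hs hn =>
    refine ⟨us, vs, {p}, w₀, ?_, rfl, ⟨rs, ws, h, hs⟩, rfl, by simpa using hn, ?_⟩
    · rcases hu with hu | ⟨q, hu, hq⟩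
      · cases hu
      · cases hu
        simpa [hp] using hq.symm
    · rintro tk' r' w' ⟨rs, ws, h, hs⟩ hd
      exact .recW _ _ _ us _ _ _ rs ws _ _ hp h hs (by simpa using hd)
  | recR => exact absurd rfl hm

/-- A field of discardable type may be regarded as taken. -/
theorem Rel.forget_field (hF : F.AbsRelAdmissible) {fs : Fin k ↪ String} {m : Mode} (hm : m ≠ .ro)
    {u : UVal S AU Ptr} {v : Val S AV} (h : Rel P F μ u v (.record k fs tk τs m) r w)
    (hj : tk j = false) (hk : Kinding noVars (τs j) {Perm.D}) :
    ∃ r₀ ⊆ r, Rel P F μ u v (.record k fs (Function.update tk j true) τs m) r₀ w := by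
  obtain ⟨us, hus⟩ : ∃ us, IsRecord μ u k fs us := by
    cases h with
    | recU _ _ us => exact ⟨us, .inl rfl⟩
    | recW p _ _ us _ _ _ _ _ _ _ hp => exact ⟨us, .inr ⟨p, rfl, hp⟩⟩
    | recR => exact absurd rfl hm
  obtain ⟨us, vs, s, w', -, rfl, hf, rfl, hd, hb⟩ := h.record_inv hm hus
  obtain ⟨r₁, w₁, r₀, w₀, h₁, hf₀, rfl, rfl, -, -⟩ := hf.take hj
  -- A discardable field owns nothing, so forgetting it leaves the owned set of the record
  -- unchanged.
  obtain rfl := h₁.writable_eq_empty hF hk (by simp)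
  rw [Set.empty_union] at hd ⊢
  exact ⟨r₀, Set.subset_union_right, hb _ _ _ hf₀
    (hd.mono_right (Set.union_subset_union_left _ Set.subset_union_right))⟩

/-- Writing a taken field, in place if the record is boxed. -/
theorem Rel.put_field [DecidableEq Ptr] (hF : F.AbsRelAdmissible) {fs : Fin k ↪ String} {m : Mode}
    (hm : m ≠ .ro) {u₁ u : UVal S AU Ptr} {v₁ v : Val S AV}
    (h : Rel P F μ u₁ v₁ (.record k fs tk τs m) r w) (hj : tk j = true)
    (hu : Rel P F μ u v (τs j) r' w')
    (hd₁ : Disjoint w' (r ∪ w)) (hd₂ : Disjoint w (r' ∪ w')) {k' : ℕ} {fs' : Fin k' ↪ String}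
    {us' : Fin k' → UVal S AU Ptr} {j' : Fin k'} (hf : fs' j' = fs j) {u₂ : UVal S AU Ptr}
    (hput : u₁ = .record k' fs' us' ∧ u₂ = .record k' fs' (Function.update us' j' u) ∧ μ' = μ ∨
      ∃ p, u₁ = .ptr p ∧ μ p = some (.record k' fs' us') ∧ u₂ = .ptr p ∧
        μ' = Function.update μ p (some (.record k' fs' (Function.update us' j' u)))) :
    ∃ vs, v₁ = .record k fs vs ∧
      Rel P F μ' u₂ (.record k fs (Function.update vs j v))
        (.record k fs (Function.update tk j false) τs m) (r' ∪ r) (w' ∪ w) ∧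
      ∀ p, μ' p = μ p ∨ p ∈ w := by
  cases h with
  | recU _ _ us vs _ _ rs ws _ _ h hs =>
    rcases hput with ⟨hu₁, rfl, rfl⟩ | ⟨p, hu₁, -⟩
    · cases hu₁
      obtain rfl := fs.injective hf
      obtain ⟨rs, ws, h, hs⟩ := FieldsRel.put ⟨rs, ws, h, hs⟩ hj hu hd₁
        (hd₂.mono_right Set.subset_union_left)
      exact ⟨vs, rfl, .recU _ _ _ _ _ _ _ _ _ _ h hs, fun p => .inl rfl⟩
    · cases hu₁
  | recW p _ _ us vs _ _ rs ws _ w₀ hp h hs hn =>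
    rcases hput with ⟨hu₁, -⟩ | ⟨q, hu₁, hq, rfl, rfl⟩
    · cases hu₁
    · cases hu₁
      rw [hp] at hq
      cases hq
      obtain rfl := fs.injective hf
      have hpn : p ∉ r' ∪ w' := fun hp' => Set.disjoint_left.1 hd₂ (.inl rfl) hp'
      have hfld := FieldsRel.put ⟨rs, ws, h, hs⟩ hj hu
        (hd₁.mono_right (Set.union_subset_union_right _ Set.subset_union_right))
        (hd₂.mono Set.subset_union_right Set.subset_union_left)
      have hpn' : p ∉ (r' ∪ r) ∪ (w' ∪ w₀) := by
        simp only [Set.mem_union, not_or] at hpn hn ⊢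
        tauto
      -- Neither the new value nor the remaining fields can reach `p`, so they still correspond
      -- after the write.
      obtain ⟨rs, ws, h, hs⟩ := hfld.of_eqOn (μ' := Function.update μ p
        (some (.record _ fs (Function.update us _ u)))) hF (fun q hq =>
          Function.update_of_ne (by rintro rfl; exact hpn' hq) _ _)
      refine ⟨vs, rfl, ?_, fun q => ?_⟩
      · rw [Set.union_left_comm]
        exact .recW _ _ _ _ _ _ _ rs ws _ _ (Function.update_self ..) h hs hpn'
      · by_cases hqp : q = p
        · exact .inr (.inl hqp)
        · exact .inl (Function.update_of_ne hqp _ _)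
  | recR => exact absurd rfl hm

end Records

/-! ## Evaluation -/

section Eval
variable {S : Sig} {AV AU Ptr : Type*} {P : Prog S} {F : Foreign S AV AU Ptr}
  {μ μ' μ₁ μ₂ : Store S AU Ptr} {U : Assoc (UVal S AU Ptr)} {V : Assoc (Val S AV)} {Γ Γ₁ Γ₂ : Ctx 0}
  {r w r₂ w₁ w₂ w₁' r₁ r₁' : Set Ptr}

/-- The frame relation does not constrain the final store on `w₁`, so the write of a `put` to an
owned pointer preserves it. -/
theorem Frame.congr_right (h : Frame w μ w₁ μ₁) (hμ : ∀ p, μ₂ p = μ₁ p ∨ p ∈ w₁) :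
    Frame w μ w₁ μ₂ where
  inertia p hp := by
    rw [h.inertia p hp, (hμ p).resolve_right fun hp' => hp (.inr hp')]
  leak_freedom p hp hp' := by
    rw [(hμ p).resolve_right hp', h.leak_freedom p hp hp']
  fresh_alloc := h.fresh_alloc

/-- The assumptions that are kept for a later expression survive the evaluation of an earlier one. -/
theorem EnvRel.step (hF : F.AbsRelAdmissible) (h : EnvRel P F U μ V Γ₂ r₂ w₂)
    (hf : Frame w₁ μ w₁' μ₁) (hd : Disjoint w₁ (r₂ ∪ w₂)) :
    EnvRel P F U μ₁ V Γ₂ r₂ w₂ ∧ Disjoint w₁' (r₂ ∪ w₂) ∧ Frame (w₁ ∪ w₂) μ (w₁' ∪ w₂) μ₁ :=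
  ⟨h.frame hF hf hd, hf.disjoint hd (h.valid hF), hf.union _⟩

/-- Both components of the result of evaluating two expressions one after the other. -/
theorem Rel.step (hF : F.AbsRelAdmissible) {u₁ : UVal S AU Ptr} {v₁ : Val S AV} {τ₁ : Ty 0}
    {w₂' r₂' : Set Ptr} (h₁ : Rel P F μ₁ u₁ v₁ τ₁ r₁' w₁') (hd : Disjoint w₁' (r₂ ∪ w₂))
    (hd' : Disjoint w₂ r₁') (hr : r₂' ⊆ r₂) (hf : Frame w₂ μ₁ w₂' μ₂) :
    Rel P F μ₂ u₁ v₁ τ₁ r₁' w₁' ∧ Disjoint w₂' (r₁' ∪ w₁') ∧ Disjoint w₁' (r₂' ∪ w₂') ∧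
      Frame (w₁' ∪ w₂) μ₁ (w₁' ∪ w₂') μ₂ := by
  have hd₁ : Disjoint w₂ (r₁' ∪ w₁') := by
    rw [Set.disjoint_union_right] at hd ⊢
    exact ⟨hd', hd.2.symm⟩
  have hd₂ := hf.disjoint hd₁ (h₁.valid hF)
  refine ⟨h₁.frame hF hf hd₁, hd₂, ?_, ?_⟩
  · rw [Set.disjoint_union_right] at hd hd₂ ⊢
    exact ⟨hd.1.mono_right hr, hd₂.2.symm⟩
  · simpa only [Set.union_comm] using hf.union w₁'

/-- The conclusion of the refinement theorem for one evaluation. -/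
def Refines (P : Prog S) (F : Foreign S AV AU Ptr) (U : Assoc (UVal S AU Ptr)) (e : Expr S 0)
    (μ : Store S AU Ptr) (u : UVal S AU Ptr) (μ' : Store S AU Ptr) : Prop :=
  ∀ (Γ : Ctx 0) (τ : Ty 0) (V : Assoc (Val S AV)) (r w : Set Ptr),
    Typing P noVars Γ e τ → EnvRel P F U μ V Γ r w →
    ∃ (v : Val S AV) (r' w' : Set Ptr), r' ⊆ r ∧ VEval P F V e v ∧ Rel P F μ' u v τ r' w' ∧
      Frame w μ w' μ'

/-- Each result has to outlive the evaluations that follow it, which is `Rel.step`. When the list is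
exhausted, the remaining context is discardable and thus owns nothing. -/
theorem refines_list (hF : F.AbsRelAdmissible) {k : ℕ} {Γs : Fin (k + 1) → Ctx 0}
    {Γ' : Fin k → Ctx 0} {es : Fin k → Expr S 0} {τs : Fin k → Ty 0}
    {μs : Fin (k + 1) → Store S AU Ptr} {us : Fin k → UVal S AU Ptr}
    (hsp : ∀ i : Fin k, Split noVars (Γs i.castSucc) (Γ' i) (Γs i.succ))
    (hw : Weaken noVars (Γs (Fin.last k)) Assoc.empty)
    (hty : ∀ i, Typing P noVars (Γ' i) (es i) (τs i))
    (ih : ∀ i, Refines P F U (es i) (μs i.castSucc) (us i) (μs i.succ))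
    (henv : EnvRel P F U (μs 0) V (Γs 0) r w) :
    ∃ (vs : Fin k → Val S AV) (rs ws : Fin k → Set Ptr) (r' w' : Set Ptr), r' ⊆ r ∧
      (∀ i, VEval P F V (es i) (vs i)) ∧
      (∀ i, Rel P F (μs (Fin.last k)) (us i) (vs i) (τs i) (rs i) (ws i)) ∧
      SepOn (fun _ => True) rs ws r' w' ∧ Frame w (μs 0) w' (μs (Fin.last k)) := by
  induction k generalizing r w with
  | zero =>
    obtain rfl := henv.writable_eq_empty hF hw
    exact ⟨Fin.elim0, Fin.elim0, Fin.elim0, ∅, ∅, Set.empty_subset _, fun i => i.elim0,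
      fun i => i.elim0, SepOn.mk_mem (fun i => i.elim0) (by simp) (by simp), Frame.refl _ _⟩
  | succ k IH =>
    obtain ⟨r₁, w₁, r₂, w₂, h₁, h₂, rfl, rfl, hd₁, hd₂⟩ := henv.split hF (hsp 0)
    obtain ⟨v, r₁', w₁', hr₁, hv, hR, hf⟩ := ih 0 _ _ V _ _ (hty 0) h₁
    obtain ⟨h₂, hd, hf'⟩ := h₂.step hF hf hd₁
    obtain ⟨vs, rs, ws, r₂', w₂', hr₂, hvs, hRs, hs, hfs⟩ :=
      IH (Γs := fun i => Γs i.succ) (Γ' := fun i => Γ' i.succ) (es := fun i => es i.succ)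
        (τs := fun i => τs i.succ) (μs := fun i => μs i.succ) (us := fun i => us i.succ)
        (fun i => hsp i.succ) hw (fun i => hty i.succ) (fun i => ih i.succ) h₂
    obtain ⟨hR, hd₂', hd₁', hf''⟩ := hR.step hF hd
      (hd₂.mono_right (hr₁.trans Set.subset_union_left)) hr₂ hfs
    refine ⟨Fin.cons v vs, Fin.cons r₁' rs, Fin.cons w₁' ws, _, _,
      Set.union_subset_union hr₁ hr₂, ?_, ?_,
      hs.cons hd₁' (hd₂'.mono_right Set.subset_union_left), hf'.trans hf''⟩
    · intro i
      induction i using Fin.cases with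
      | zero => exact hv
      | succ i => exact hvs i
    · intro i
      induction i using Fin.cases with
      | zero => exact hR
      | succ i => exact hRs i

/-- Evaluation of an expression under the binder of an earlier result. -/
theorem Refines.bind (hF : F.AbsRelAdmissible) {u₁ u : UVal S AU Ptr} {v₁ : Val S AV} {ρ τ : Ty 0}
    {x : String} {e : Expr S 0} (ih : Refines P F (U.bind x u₁) e μ₁ u μ₂)
    (hR : Rel P F μ₁ u₁ v₁ ρ r₁' w₁') (hf : Frame w₁ μ w₁' μ₁)
    (h₂ : EnvRel P F U μ V Γ₂ r₂ w₂) (hd : Disjoint w₁ (r₂ ∪ w₂)) (hd' : Disjoint w₂ r₁')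
    (hx : Γ₂ x = none) (hty : Typing P noVars (Γ₂.bind x ρ) e τ) :
    ∃ (v : Val S AV) (r' w' : Set Ptr), r' ⊆ r₁' ∪ r₂ ∧ VEval P F (V.bind x v₁) e v ∧
      Rel P F μ₂ u v τ r' w' ∧ Frame (w₁ ∪ w₂) μ w' μ₂ := by
  obtain ⟨h₂, hd, hf'⟩ := h₂.step hF hf hd
  obtain ⟨v, r', w', hr, hv, hR', hf''⟩ := ih _ _ _ _ _ hty (h₂.bind hx hR hd hd')
  exact ⟨v, r', w', hr, hv, hR', hf'.trans hf''⟩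

/-- `IsRecord` treats boxed and unboxed records alike: the set `s` given by `Rel.record_inv`, the
box itself if there is one, stays with the record. -/
theorem Refines.take (hF : F.AbsRelAdmissible) {u₁ u : UVal S AU Ptr} {x f y : String}
    {e₁ e₂ : Expr S 0} {k : ℕ} {fs : Fin k ↪ String} {us : Fin k → UVal S AU Ptr} {j : Fin k}
    (ih₁ : Refines P F U e₁ μ u₁ μ₁) (hu : IsRecord μ₁ u₁ k fs us) (hf : fs j = f)
    (ih₂ : Refines P F ((U.bind y (us j)).bind x u₁) e₂ μ₁ u μ₂) :
    Refines P F U (.take x f y e₁ e₂) μ u μ₂ := by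
  intro Γ τ V r w hty henv
  cases hty with
  | take₁ _ Γ₁ Γ₂ _ _ _ _ _ k' fs' tk τs m j' _ hsp hm hf' ht hty₁ hxy hx hy hty₂ =>
    obtain ⟨r₁, w₁, r₂, w₂, h₁, h₂, rfl, rfl, hd₁, hd₂⟩ := henv.split hF hsp
    obtain ⟨v₁, r₁', w₁', hr₁, hv₁, hR₁, hf₁⟩ := ih₁ _ _ V _ _ hty₁ h₁
    obtain ⟨us', vs, s, w₀, heq, rfl, hflds, rfl, hds, hb⟩ := hR₁.record_inv hm hu
    cases heq
    obtain rfl := fs.injective (hf'.trans hf.symm)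
    obtain ⟨h₂, hd, hf'⟩ := h₂.step hF hf₁ hd₁
    obtain ⟨ra, wa, rb, wb, hRa, hflds', rfl, rfl, hda, hdb⟩ := hflds.take ht
    have hRb := hb _ _ _ hflds' (hds.mono_right (by gcongr <;> exact Set.subset_union_right))
    have hd₂' := hd₂.mono_right (hr₁.trans Set.subset_union_left)
    simp only [Set.disjoint_union_left, Set.disjoint_union_right] at hd hds hda hdb hd₂'
    have henv' := (h₂.bind hy hRa (by simp [hd]) (by simp [hd₂'])).bind (x := x)
      (by simp [Assoc.bind, hxy, hx]) hRb
      (by simp only [Set.disjoint_union_left, Set.disjoint_union_right]; tauto)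
      (by simp only [Set.disjoint_union_left]; tauto)
    obtain ⟨v, r', w', hr, hv, hR, hf₂⟩ := ih₂ _ _ _ _ _ hty₂ henv'
    refine ⟨v, r', w', hr.trans ?_, .take _ _ _ _ _ _ _ _ _ _ _ hv₁ hf hv, hR, hf'.trans ?_⟩
    · rw [Set.union_left_comm, ← Set.union_assoc]
      exact Set.union_subset_union_left _ hr₁
    · rwa [show s ∪ (wa ∪ wb) ∪ w₂ = s ∪ wb ∪ (wa ∪ w₂) by ac_rfl]
  | take₂ _ Γ₁ Γ₂ _ _ _ _ _ k' fs' tk τs m j' _ hsp hk hm hf' ht hty₁ hxy hx hy hty₂ =>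
    obtain ⟨r₁, w₁, r₂, w₂, h₁, h₂, rfl, rfl, hd₁, hd₂⟩ := henv.split hF hsp
    obtain ⟨v₁, r₁', w₁', hr₁, hv₁, hR₁, hf₁⟩ := ih₁ _ _ V _ _ hty₁ h₁
    -- Here the record stays whole, so `x` and `y` both reach the pointers of the field. These are
    -- read-only since the field is shareable, and `hdisj` keeps them apart from what the record
    -- owns.
    have hdisj := hR₁.disjoint hF
    obtain ⟨us', vs, s, w₀, heq, rfl, hflds, rfl, hds, hb⟩ := hR₁.record_inv hm hu
    cases heq
    obtain rfl := fs.injective (hf'.trans hf.symm)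
    obtain ⟨h₂, hd, hf'⟩ := h₂.step hF hf₁ hd₁
    obtain ⟨ra, hra, wa, hwa, hRa⟩ := hflds.get ht
    obtain rfl := hRa.writable_eq_empty hF hk (by simp)
    have hd₂' := hd₂.mono_right (hr₁.trans Set.subset_union_left)
    have henv' := (h₂.bind hy hRa (by simp) (hd₂'.mono_right hra)).bind (x := x)
      (by simp [Assoc.bind, hxy, hx]) hR₁
      (by
        simp only [Set.disjoint_union_right] at hd ⊢
        exact ⟨⟨hdisj.symm.mono_right hra, hd.1⟩, by simp, hd.2⟩)
      (by simpa using hd₂')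
    obtain ⟨v, r', w', hr, hv, hR, hf₂⟩ := ih₂ _ _ _ _ _ hty₂ henv'
    refine ⟨v, r', w', hr.trans ?_, .take _ _ _ _ _ _ _ _ _ _ _ hv₁ hf hv, hR, hf'.trans ?_⟩
    · rw [← Set.union_assoc, Set.union_eq_self_of_subset_right hra]
      exact Set.union_subset_union_left _ hr₁
    · simpa using hf₂

theorem Refines.put [DecidableEq Ptr] (hF : F.AbsRelAdmissible) {u₁ u u₂ : UVal S AU Ptr}
    {f : String} {e₁ e₂ : Expr S 0} {k : ℕ} {fs : Fin k ↪ String} {us : Fin k → UVal S AU Ptr}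
    {j : Fin k} (ih₁ : Refines P F U e₁ μ u₁ μ₁) (ih₂ : Refines P F U e₂ μ₁ u μ₂) (hf : fs j = f)
    (hput : u₁ = .record k fs us ∧ u₂ = .record k fs (Function.update us j u) ∧ μ' = μ₂ ∨
      ∃ p, u₁ = .ptr p ∧ μ₂ p = some (.record k fs us) ∧ u₂ = .ptr p ∧
        μ' = Function.update μ₂ p (some (.record k fs (Function.update us j u)))) :
    Refines P F U (.put e₁ f e₂) μ u₂ μ' := by
  -- Both typing rules reduce to filling a taken field: `tk'` is `tk` itself for `put₁`, and `tk`
  -- with the discardable field marked as taken for `put₂`.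
  have core : ∀ {Γ Γ₁ Γ₂ : Ctx 0} {V : Assoc (Val S AV)} {r w : Set Ptr} {k' : ℕ}
      {fs' : Fin k' ↪ String} {tk tk' : Fin k' → Bool} {τs : Fin k' → Ty 0} {m : Mode}
      {j' : Fin k'}, EnvRel P F U μ V Γ r w → Split noVars Γ Γ₁ Γ₂ → m ≠ .ro → fs' j' = f →
      Typing P noVars Γ₁ e₁ (.record k' fs' tk τs m) → Typing P noVars Γ₂ e₂ (τs j') →
      tk' j' = true → (∀ {v r w}, Rel P F μ₁ u₁ v (.record k' fs' tk τs m) r w →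
        ∃ r₀ ⊆ r, Rel P F μ₁ u₁ v (.record k' fs' tk' τs m) r₀ w) →
      ∃ (v : Val S AV) (r' w' : Set Ptr), r' ⊆ r ∧ VEval P F V (.put e₁ f e₂) v ∧
        Rel P F μ' u₂ v (.record k' fs' (Function.update tk' j' false) τs m) r' w' ∧
        Frame w μ w' μ' := by
    intro Γ Γ₁ Γ₂ V r w k' fs' tk tk' τs m j' henv hsp hm hf' hty₁ hty₂ ht hforget
    obtain ⟨r₁, w₁, r₂, w₂, h₁, h₂, rfl, rfl, hd₁, hd₂⟩ := henv.split hF hsp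
    obtain ⟨v₁, r₁', w₁', hr₁, hv₁, hR₁, hf₁⟩ := ih₁ _ _ V _ _ hty₁ h₁
    obtain ⟨r₀, hr₀, hR₁⟩ := hforget hR₁
    obtain ⟨h₂, hd, hfr⟩ := h₂.step hF hf₁ hd₁
    obtain ⟨v₂, r₂', w₂', hr₂, hv₂, hR₂, hf₂⟩ := ih₂ _ _ V _ _ hty₂ h₂
    obtain ⟨hR₁, hd₂', hd₁', hfr'⟩ := hR₁.step hF hd
      (hd₂.mono_right ((hr₀.trans hr₁).trans Set.subset_union_left)) hr₂ hf₂
    obtain ⟨vs, rfl, hR, hμ⟩ := hR₁.put_field hF hm ht hR₂ hd₂' hd₁' (hf.trans hf'.symm) hput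
    refine ⟨_, _, _, ?_, .put _ _ _ _ _ _ _ _ _ hv₁ hf' hv₂, hR, ?_⟩
    · rw [Set.union_comm]
      exact Set.union_subset_union (hr₀.trans hr₁) hr₂
    · rw [Set.union_comm w₂']
      exact (hfr.trans hfr').congr_right fun p => (hμ p).imp_right .inl
  intro Γ τ V r w hty henv
  cases hty with
  | put₁ _ Γ₁ Γ₂ _ _ _ k' fs' tk τs m j' hsp hm hf' ht hty₁ hty₂ =>
    exact core henv hsp hm hf' hty₁ hty₂ ht fun h => ⟨_, subset_rfl, h⟩
  | put₂ _ Γ₁ Γ₂ _ _ _ k' fs' tk τs m j' hsp hm hf' ht hty₁ hk hty₂ =>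
    have := core (tk' := Function.update tk j' true) henv hsp hm hf' hty₁ hty₂ (by simp)
      fun h => h.forget_field hF hm ht hk
    rwa [Function.update_idem, ← ht, Function.update_eq_self] at this

theorem Refines.member (hF : F.AbsRelAdmissible) {u₁ : UVal S AU Ptr} {f : String} {e : Expr S 0}
    {k : ℕ} {fs : Fin k ↪ String} {us : Fin k → UVal S AU Ptr} {j : Fin k}
    (ih : Refines P F U e μ u₁ μ₁) (hu : IsRecord μ₁ u₁ k fs us) (hf : fs j = f) :
    Refines P F U (.member e f) μ (us j) μ₁ := by
  intro Γ τ V r w hty henv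
  cases hty with | member _ _ _ k' fs' tk τs m j' hk hf' ht hty =>
  obtain ⟨v₁, r₁, w₁, hr, hv, hR, hfr⟩ := ih _ _ V _ _ hty henv
  obtain rfl := hR.writable_eq_empty hF hk (by simp)
  have : ∃ us' vs, UVal.record (AU := AU) (Ptr := Ptr) k fs us = .record k' fs' us' ∧
      v₁ = .record k' fs' vs ∧ ∃ r₀ ⊆ r₁, FieldsRel P F μ₁ us' vs tk τs r₀ ∅ := by
    -- Read-only boxes are outside the scope of `Rel.record_inv` and are inverted directly; nothing
    -- is rebuilt, so reading their fields suffices.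
    by_cases hm : m = .ro
    · subst hm
      cases hR with | recR p _ _ us' vs _ _ rs ws r₀ hp h hs =>
      refine ⟨us', vs, ?_, rfl, r₀, Set.subset_union_right, rs, ws, h, hs⟩
      rcases hu with hu | ⟨q, hu, hq⟩
      · cases hu
      · cases hu
        simpa [hp] using hq.symm
    · obtain ⟨us', vs, s, w₀, heq, hv, hflds, hw, -, -⟩ := hR.record_inv hm hu
      obtain rfl : w₀ = ∅ := (Set.union_empty_iff.1 hw.symm).2
      exact ⟨us', vs, heq, hv, r₁, subset_rfl, hflds⟩
  obtain ⟨us', vs, heq, rfl, r₀, hr₀, hflds⟩ := this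
  cases heq
  obtain rfl := fs.injective (hf'.trans hf.symm)
  obtain ⟨r', hr', w', hw', hR'⟩ := hflds.get ht
  obtain rfl := Set.subset_empty_iff.1 hw'
  exact ⟨_, r', ∅, (hr'.trans hr₀).trans hr, .member _ _ _ _ _ _ _ hv hf, hR', hfr⟩

end Eval

theorem Rel.lit_inv {S : Sig} {AV AU Ptr : Type*} {P : Prog S} {F : Foreign S AV AU Ptr}
    {μ : Store S AU Ptr} {l : ℕ} {v : Val S AV} {τ : Ty 0} {r w : Set Ptr}
    (h : Rel P F μ (.lit l) v τ r w) : v = .lit l ∧ w = ∅ := by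
  cases h
  exact ⟨rfl, rfl⟩

/-- Value-to-update refinement: evaluation in the update semantics preserves the correspondence. -/
theorem UEval.refines {S : Sig} {AV AU Ptr : Type*} {P : Prog S} (hP : P.WellTyped)
    {F : Foreign S AV AU Ptr} (hF : F.AbsRelAdmissible) (hfun : F.FunsCorrespond P)
    {U : Assoc (UVal S AU Ptr)} {e : Expr S 0} {μ μ' : Store S AU Ptr} {u : UVal S AU Ptr}
    (h : UEval P F U e μ u μ') : Refines P F U e μ u μ' := by
  induction h with
  | var U x μ u hu =>
    intro Γ τ V r w hty henv
    cases hty with | var _ _ _ hw =>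
    obtain ⟨r', hr, rs, ws, hv, hs⟩ := henv.weaken hF hw
    have hs : SepOn _ rs ws r' w := hs
    obtain ⟨u', v, hu', hv, hR⟩ := hv x τ (by simp [Assoc.bind])
    obtain rfl : u = u' := by simpa [hu] using hu'
    -- After weakening only `x` is left, so the context owns exactly what the returned value owns.
    obtain rfl : w = ws x := by
      ext p
      rw [hs.mem_right]
      constructor
      · rintro ⟨y, hy, hp⟩
        by_cases hyx : y = x
        · rwa [← hyx]
        · simp [Assoc.bind, Assoc.empty, hyx] at hy
      · exact fun hp => ⟨x, by simp [Assoc.bind], hp⟩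
    exact ⟨v, rs x, ws x, (hs.left_subset (by simp [Assoc.bind])).trans hr, .var _ _ _ hv, hR,
      Frame.refl _ _⟩
  | unit U μ =>
    intro Γ τ V r w hty henv
    cases hty with | unit _ hw =>
    obtain rfl := henv.writable_eq_empty hF hw
    exact ⟨_, ∅, ∅, Set.empty_subset _, .unit _, .unit, Frame.refl _ _⟩
  | funC U f ρs π x e μ hf =>
    intro Γ τ V r w hty henv
    cases hty with | tapp _ _ _ hw hk =>
    obtain rfl := henv.writable_eq_empty hF hw
    refine ⟨_, ∅, ∅, Set.empty_subset _, .funC _ _ _ _ _ _ hf, .funC _ _ _ _ ?_, Frame.refl _ _⟩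
    rw [hf] at hk ⊢
    -- The body is typed under the kinds of the signature, which the type arguments satisfy by `hk`.
    have := (hP f π x e hf).subst hk
    rwa [Ctx.subst_bind, Ctx.subst_empty] at this
  | funA U f ρs π μ hf =>
    intro Γ τ V r w hty henv
    cases hty with | tapp _ _ _ hw hk =>
    obtain rfl := henv.writable_eq_empty hF hw
    rw [hf] at hk ⊢
    exact ⟨_, ∅, ∅, Set.empty_subset _, .funA _ _ _ _ hf, .funA _ _ _ hf hk, Frame.refl _ _⟩
  | lit U l μ =>
    intro Γ τ V r w hty henv
    cases hty with | lit _ _ t hw hl =>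
    obtain rfl := henv.writable_eq_empty hF hw
    exact ⟨_, ∅, ∅, Set.empty_subset _, .lit _ _, .lit _ _ hl, Frame.refl _ _⟩
  | cast U t e l μ μ' _ ih =>
    intro Γ τ V r w hty henv
    cases hty with | cast _ _ t' _ hty hb =>
    obtain ⟨v, r', w', hr, hv, hR, hf⟩ := ih _ _ V _ _ hty henv
    cases hR with | lit _ _ hl =>
    exact ⟨_, ∅, ∅, hr, .cast _ _ _ _ hv, .lit _ _ (hl.trans_le hb), hf⟩
  | appC U e₁ e₂ x e u' u μ μ₁ μ₂ μ₃ _ _ _ ih₁ ih₂ ih₃ =>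
    intro Γ τ V r w hty henv
    cases hty with | app _ Γ₁ Γ₂ _ _ ρ _ hsp hty₁ hty₂ =>
    obtain ⟨r₁, w₁, r₂, w₂, h₁, h₂, rfl, rfl, hd₁, hd₂⟩ := henv.split hF hsp
    obtain ⟨v₁, r₁', w₁', hr₁, hv₁, hR₁, hf₁⟩ := ih₁ _ _ V _ _ hty₁ h₁
    obtain ⟨h₂, -, hf⟩ := h₂.step hF hf₁ hd₁
    cases hR₁ with | funC _ _ _ _ hty₃ =>
    obtain ⟨v₂, r₂', w₂', hr₂, hv₂, hR₂, hf₂⟩ := ih₂ _ _ V _ _ hty₂ h₂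
    -- The typing `hty₃` of the body was carried by the correspondence of the function values. The
    -- body runs in an environment that holds the argument alone, hence owns exactly what the
    -- argument owns.
    obtain ⟨v, r', w', hr, hv, hR, hf₃⟩ := ih₃ _ _ (Assoc.empty.bind x v₂) _ _ hty₃
      ((EnvRel.empty Assoc.empty μ₂ Assoc.empty).bind rfl hR₂ (by simp) (by simp))
    rw [Set.empty_union] at hf
    rw [Set.union_empty] at hr hf₃
    exact ⟨v, r', w', (hr.trans hr₂).trans Set.subset_union_right, .appC _ _ _ _ _ _ _ hv₁ hv₂ hv,
      hR, (hf.trans hf₂).trans hf₃⟩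
  | appA U e₁ e₂ f ρs u' u μ μ₁ μ₂ μ₃ _ _ hu ih₁ ih₂ =>
    intro Γ τ V r w hty henv
    cases hty with | app _ Γ₁ Γ₂ _ _ ρ _ hsp hty₁ hty₂ =>
    obtain ⟨r₁, w₁, r₂, w₂, h₁, h₂, rfl, rfl, hd₁, hd₂⟩ := henv.split hF hsp
    obtain ⟨v₁, r₁', w₁', hr₁, hv₁, hR₁, hf₁⟩ := ih₁ _ _ V _ _ hty₁ h₁
    obtain ⟨h₂, -, hf⟩ := h₂.step hF hf₁ hd₁
    cases hR₁ with | funA _ π _ hπ hk =>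
    obtain ⟨v₂, r₂', w₂', hr₂, hv₂, hR₂, hf₂⟩ := ih₂ _ _ V _ _ hty₂ h₂
    obtain ⟨r', hr, w', hR, hf₃⟩ := hfun f π ρs hπ hk _ _ _ _ _ _ _ _ hR₂ rfl hu
    rw [Set.empty_union] at hf
    exact ⟨_, r', w', (hr.trans hr₂).trans Set.subset_union_right, .appA _ _ _ _ _ _ _ hv₁ hv₂ rfl,
      hR, (hf.trans hf₂).trans hf₃⟩
  | primop U o es l μs μ μ' h₀ _ hl ih =>
    intro Γ τ V r w hty henv
    subst h₀ hl
    cases hty with | primop _ _ _ Γ' hsp hty =>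
    obtain ⟨Γs, rfl, hsp, hw⟩ := hsp
    obtain ⟨vs, rs, ws, r', w', hr, hvs, hRs, hs, hf⟩ := refines_list hF hsp hw hty ih henv
    -- All arguments are literals and own nothing, like the result of the operator.
    obtain rfl : w' = ∅ := hs.right_eq_empty fun i _ => (hRs i).lit_inv.2
    exact ⟨_, ∅, ∅, Set.empty_subset _, .primop _ _ _ l fun i => (hRs i).lit_inv.1 ▸ hvs i,
      .lit _ _ (Fin.is_lt _), hf⟩
  | letE U x e₁ e₂ u' u μ μ₁ μ₂ _ _ ih₁ ih₂ =>
    intro Γ τ V r w hty henv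
    cases hty with | letE _ Γ₁ Γ₂ _ _ _ ρ _ hsp hty₁ hx hty₂ =>
    obtain ⟨r₁, w₁, r₂, w₂, h₁, h₂, rfl, rfl, hd₁, hd₂⟩ := henv.split hF hsp
    obtain ⟨v₁, r₁', w₁', hr₁, hv₁, hR₁, hf₁⟩ := ih₁ _ _ V _ _ hty₁ h₁
    obtain ⟨v, r', w', hr, hv, hR, hf⟩ := ih₂.bind hF hR₁ hf₁ h₂ hd₁
      (hd₂.mono_right (hr₁.trans Set.subset_union_left)) hx hty₂
    exact ⟨v, r', w', hr.trans (Set.union_subset_union_left _ hr₁), .letE _ _ _ _ _ _ hv₁ hv, hR,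
      hf⟩
  | letBang U ys x e₁ e₂ u' u μ μ₁ μ₂ _ _ ih₁ ih₂ =>
    intro Γ τ V r w hty henv
    cases hty with | letBang _ Γ₁ Γ₂ _ _ _ _ ρ _ hys hsp hk hty₁ hx hx' hty₂ =>
    obtain ⟨r₁, w₁, r₂, w₂, h₁, h₂, hr₂, rfl, hd₁⟩ := henv.letBang hF hsp
    obtain ⟨v₁, r₁', w₁', hr₁, hv₁, hR₁, hf₁⟩ := ih₁ _ _ V _ _ hty₁ h₁
    -- The read-only pointers of the first environment include those that `ys` own afterwards;
    -- escapability guarantees that the bound value retains none of them.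
    obtain rfl := hR₁.readonly_eq_empty hF hk
    obtain ⟨v, r', w', hr, hv, hR, hf⟩ := ih₂.bind hF hR₁ hf₁ h₂ hd₁ (by simp) (by simp [hx, hx'])
      hty₂
    rw [Set.empty_union] at hr
    exact ⟨v, r', w', hr.trans hr₂, .letBang _ _ _ _ _ _ _ hv₁ hv, hR, hf⟩
  | iteT U e₁ e₂ e₃ u μ μ₁ μ₂ _ _ ih₁ ih₂ =>
    intro Γ τ V r w hty henv
    cases hty with | ite _ Γ₁ Γ₂ _ _ _ _ hsp hty₁ hty₂ hty₃ =>
    obtain ⟨r₁, w₁, r₂, w₂, h₁, h₂, rfl, rfl, hd₁, hd₂⟩ := henv.split hF hsp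
    obtain ⟨v₁, r₁', w₁', hr₁, hv₁, hR₁, hf₁⟩ := ih₁ _ _ V _ _ hty₁ h₁
    obtain ⟨h₂, -, hf⟩ := h₂.step hF hf₁ hd₁
    cases hR₁
    obtain ⟨v, r', w', hr, hv, hR, hf₂⟩ := ih₂ _ _ V _ _ hty₂ h₂
    rw [Set.empty_union] at hf
    exact ⟨v, r', w', hr.trans Set.subset_union_right, .iteT _ _ _ _ _ hv₁ hv, hR, hf.trans hf₂⟩
  | iteF U e₁ e₂ e₃ u μ μ₁ μ₂ _ _ ih₁ ih₂ =>
    intro Γ τ V r w hty henv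
    cases hty with | ite _ Γ₁ Γ₂ _ _ _ _ hsp hty₁ hty₂ hty₃ =>
    obtain ⟨r₁, w₁, r₂, w₂, h₁, h₂, rfl, rfl, hd₁, hd₂⟩ := henv.split hF hsp
    obtain ⟨v₁, r₁', w₁', hr₁, hv₁, hR₁, hf₁⟩ := ih₁ _ _ V _ _ hty₁ h₁
    obtain ⟨h₂, -, hf⟩ := h₂.step hF hf₁ hd₁
    cases hR₁
    obtain ⟨v, r', w', hr, hv, hR, hf₂⟩ := ih₂ _ _ V _ _ hty₃ h₂
    rw [Set.empty_union] at hf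
    exact ⟨v, r', w', hr.trans Set.subset_union_right, .iteF _ _ _ _ _ hv₁ hv, hR, hf.trans hf₂⟩
  | con U C e u μ μ' _ ih =>
    intro Γ τ V r w hty henv
    cases hty with | con _ _ _ τ hty =>
    obtain ⟨v, r', w', hr, hv, hR, hf⟩ := ih _ _ V _ _ hty henv
    exact ⟨_, r', w', hr, .con _ _ _ _ hv, .variant _ _ _ _ _ (Finset.mem_singleton_self C) _ _ hR,
      hf⟩
  | promote U cs τs e C u μ μ' _ ih =>
    intro Γ τ V r w hty henv
    cases hty with | promote _ _ bs ρs _ _ hsub hty heq =>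
    obtain ⟨v, r', w', hr, hv, hR, hf⟩ := ih _ _ V _ _ hty henv
    cases hR with | variant _ _ v _ _ hC _ _ hR =>
    exact ⟨_, r', w', hr, .promote _ _ _ _ _ _ hv,
      .variant _ _ _ _ _ (hsub hC) _ _ (by rwa [heq ⟨C, hC⟩]), hf⟩
  | case₁ U e₁ C x e₂ y e₃ u' u μ μ₁ μ₂ _ _ ih₁ ih₂ =>
    intro Γ τ V r w hty henv
    cases hty with | case _ Γ₁ Γ₂ _ _ _ _ _ _ cs τs hA _ hsp hty₁ hx hty₂ hy hty₃ =>
    obtain ⟨r₁, w₁, r₂, w₂, h₁, h₂, rfl, rfl, hd₁, hd₂⟩ := henv.split hF hsp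
    obtain ⟨v₁, r₁', w₁', hr₁, hv₁, hR₁, hf₁⟩ := ih₁ _ _ V _ _ hty₁ h₁
    cases hR₁ with | variant _ _ v₁ _ _ hC _ _ hR₁ =>
    obtain ⟨v, r', w', hr, hv, hR, hf⟩ := ih₂.bind hF hR₁ hf₁ h₂ hd₁
      (hd₂.mono_right (hr₁.trans Set.subset_union_left)) hx hty₂
    exact ⟨v, r', w', hr.trans (Set.union_subset_union_left _ hr₁),
      .case₁ _ _ _ _ _ _ _ _ _ hv₁ hv, hR, hf⟩
  | case₂ U e₁ C x e₂ y e₃ B u' u μ μ₁ μ₂ _ hB _ ih₁ ih₂ =>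
    intro Γ τ V r w hty henv
    cases hty with | case _ Γ₁ Γ₂ _ _ _ _ _ _ cs τs hA _ hsp hty₁ hx hty₂ hy hty₃ =>
    obtain ⟨r₁, w₁, r₂, w₂, h₁, h₂, rfl, rfl, hd₁, hd₂⟩ := henv.split hF hsp
    obtain ⟨v₁, r₁', w₁', hr₁, hv₁, hR₁, hf₁⟩ := ih₁ _ _ V _ _ hty₁ h₁
    cases hR₁ with | variant _ _ v₁ _ _ hC _ _ hR₁ =>
    obtain ⟨v, r', w', hr, hv, hR, hf⟩ := ih₂.bind hF
      (.variant _ _ _ _ _ (Finset.mem_erase.2 ⟨hB, hC⟩) _ _ hR₁) hf₁ h₂ hd₁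
      (hd₂.mono_right (hr₁.trans Set.subset_union_left)) hy hty₃
    exact ⟨v, r', w', hr.trans (Set.union_subset_union_left _ hr₁),
      .case₂ _ _ _ _ _ _ _ _ _ _ hv₁ hB hv, hR, hf⟩
  | esac U e C u μ μ' _ ih =>
    intro Γ τ V r w hty henv
    cases hty with | esac _ _ C' _ hty =>
    obtain ⟨v, r', w', hr, hv, hR, hf⟩ := ih _ _ V _ _ hty henv
    cases hR with | variant _ _ v _ _ hC _ _ hR =>
    exact ⟨_, r', w', hr, .esac _ _ _ _ hv, hR, hf⟩
  | struct U k fs es us μs μ μ' h₀ _ hl ih =>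
    intro Γ τ V r w hty henv
    subst h₀ hl
    cases hty with | struct _ _ _ _ τs Γ' hsp hty =>
    obtain ⟨Γs, rfl, hsp, hw⟩ := hsp
    obtain ⟨vs, rs, ws, r', w', hr, hvs, hRs, hs, hf⟩ := refines_list hF hsp hw hty ih henv
    exact ⟨_, r', w', hr, .struct _ _ _ _ _ hvs,
      .recU _ _ _ _ _ _ rs ws _ _ (fun i _ => hRs i) (by simpa [Separated, SepOn] using hs), hf⟩
  | member₁ U e f k fs us j μ μ' _ hf ih => exact ih.member hF (.inl rfl) hf
  | member₂ U e f p k fs us j μ μ' _ hp hf ih => exact ih.member hF (.inr ⟨p, rfl, hp⟩) hf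
  | take₁ U x f y e₁ e₂ k fs us j u μ μ₁ μ₂ _ hf _ ih₁ ih₂ => exact ih₁.take hF (.inl rfl) hf ih₂
  | take₂ U x f y e₁ e₂ p k fs us j u μ μ₁ μ₂ _ hp hf _ ih₁ ih₂ =>
    exact ih₁.take hF (.inr ⟨p, rfl, hp⟩) hf ih₂
  | put₁ U e₁ f e₂ k fs us j u' μ μ₁ μ₂ _ hf _ ih₁ ih₂ =>
    classical exact ih₁.put hF ih₂ hf (.inl ⟨rfl, rfl, rfl⟩)
  | put₂ U e₁ f e₂ p k fs us j u' μ μ₁ μ₂ _ _ hp hf ih₁ ih₂ =>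
    classical exact ih₁.put hF ih₂ hf (.inr ⟨p, rfl, hp, rfl, rfl⟩)

end Cogent

theorem theorem2 {S : Cogent.Sig} {AV AU Ptr : Type*}
    (P : Cogent.Prog S) (hP : P.WellTyped)
    (F : Cogent.Foreign S AV AU Ptr) (hrel : F.AbsRelAdmissible) (hfun : F.FunsCorrespond P)
    (Γ : Cogent.Ctx 0) (e : Cogent.Expr S 0) (τ : Cogent.Ty 0)
    (U : Cogent.Assoc (Cogent.UVal S AU Ptr)) (V : Cogent.Assoc (Cogent.Val S AV))
    (μ μ' : Cogent.Store S AU Ptr) (u : Cogent.UVal S AU Ptr) (r w : Set Ptr)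
    (hty : Cogent.Typing P Cogent.noVars Γ e τ)
    (henv : Cogent.EnvRel P F U μ V Γ r w)
    (heval : Cogent.UEval P F U e μ u μ') :
    ∃ (v : Cogent.Val S AV) (r' w' : Set Ptr), r' ⊆ r ∧
      Cogent.VEval P F V e v ∧
      Cogent.Rel P F μ' u v τ r' w' ∧
      Cogent.Frame w μ w' μ' :=
  heval.refines hP hrel hfun Γ τ V r w hty henv
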